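/- Let $d\ge 2$. There exist a standard Borel probability space $(X,\lambda)$ and a $\lambda$-preserving action of the free group $\mathbb{F}_d$ with free generators $a_1,\dots,a_d$ on $X$ by measurable maps such that the Schreier graph $\mathcal{T}$ of the action, in which distinct $x,y\in X$ are adjacent if and only if $y=a_i x$ or $x=a_i y$ for some $i$, is a $2d$-regular treeing, and such that the only circulations in $L^2(E(\mathcal{T}),\eta)$ are the linear combinations of the $d$ circulations given by the generators. Here a treeing is a graphing (a graph on $(X,\lambda)$ whose edge set $E(\mathcal T)\subseteq X\times X$ of directed edges is a countable union of graphs of measure preserving partial injections between Borel sets) in which the connected component of almost every vertex is acyclic. The edge measure is $\eta(S)=\frac1{2d}\int_X\deg_S(x)\,d\lambda(x)$, where $\deg_S(x)$ is the number of neighbours $y$ of $x$ with $(x,y)\in S$. A circulation is a function $f:E(\mathcal{T})\to\mathbb{R}$ with $f(y,x)=-f(x,y)$ for almost every edge $(x,y)$ and $\sum_{y:(x,y)\in E(\mathcal{T})}f(x,y)=0$ for almost every vertex $x$. The circulation given by $a_i$ takes the value $1$ on $(x,a_ix)$ and $-1$ on $(a_ix,x)$ for every $x\in X$, and $0$ on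 all other edges. Elements of $L^2(E(\mathcal{T}),\eta)$ are identified if they agree $\eta$-almost everywhere. -/

import Mathlib

open MeasureTheory
open scoped ENNReal

/-- `G` is a graphing on `(X, μ)`: its set of directed edges `{(x, y) | x and y adjacent}` is a
countable union of graphs of measure preserving partial functions, that is, of measurable
injective maps `φ n` defined on measurable sets `A n` such that `φ n` maps every measurable subset
of `A n` to a set of the same measure. -/
def IsGraphing {X : Type*} [MeasurableSpace X] (G : SimpleGraph X) (μ : Measure X) : Prop :=
  ∃ (A : ℕ → Set X) (φ : ℕ → X → X),
    (∀ n, MeasurableSet (A n) ∧ Measurable (fun x : A n => φ n x) ∧ Set.InjOn (φ n) (A n) ∧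
      ∀ S ⊆ A n, MeasurableSet S → μ (φ n '' S) = μ S) ∧
    ∀ x y, G.Adj x y ↔ ∃ n, x ∈ A n ∧ φ n x = y

/-- A treeing is a graphing that is essentially acyclic: the connected component of almost every
vertex is acyclic. -/
def IsTreeing {X : Type*} [MeasurableSpace X] (G : SimpleGraph X) (μ : Measure X) : Prop :=
  IsGraphing G μ ∧ ∀ᵐ x ∂μ, (G.connectedComponentMk x).toSimpleGraph.IsAcyclic

/-- Every vertex has exactly `D` neighbours. -/
def IsRegularGraph {X : Type*} (G : SimpleGraph X) (D : ℕ) : Prop :=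
  ∀ x, (G.neighborSet x).encard = D

/-- The normalized edge measure of a `D`-regular graphing, as a measure on `X × X`:
`η(S) = (1 / D) ∫ deg_S(x) dμ(x)`, where `deg_S(x)` is the number of neighbours `y` of `x`
with `(x, y) ∈ S`. -/
noncomputable def edgeMeasure {X : Type*} [MeasurableSpace X] (G : SimpleGraph X) (μ : Measure X)
    (D : ℕ) : Measure (X × X) :=
  (D : ℝ≥0∞)⁻¹ • μ.bind fun x => Measure.sum fun y : G.neighborSet x => Measure.dirac (x, (y : X))

open Classical in
theorem measurable_sum_dirac_neighborSet {X : Type*} [MeasurableSpace X] [StandardBorelSpace X]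
    {G : SimpleGraph X} {μ : Measure X} (h : IsGraphing G μ) :
    Measurable fun x => Measure.sum fun y : G.neighborSet x => Measure.dirac (x, (y : X)) := by
  obtain ⟨A, φ, hA, hG⟩ := h
  refine Measure.measurable_of_measurable_coe _ fun S hS => ?_
  let P : ℕ → X → Prop := fun n x => x ∈ A n ∧ ∀ m < n, ¬ (x ∈ A m ∧ φ m x = φ n x)
  have key : ∀ x, (Measure.sum fun y : G.neighborSet x => Measure.dirac (x, (y : X))) S
      = ∑' n, (if P n x ∧ (x, φ n x) ∈ S then (1 : ℝ≥0∞) else 0) := by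
    intro x
    rw [Measure.sum_apply _ hS]
    have hex : ∀ y : G.neighborSet x, ∃ n, x ∈ A n ∧ φ n x = y := fun y => (hG x y).1 y.2
    let N : G.neighborSet x → ℕ := fun y => Nat.find (hex y)
    have hN : ∀ y, x ∈ A (N y) ∧ φ (N y) x = y := fun y => Nat.find_spec (hex y)
    have hNinj : Function.Injective N := by
      intro y z hyz
      apply Subtype.ext
      rw [← (hN y).2, ← (hN z).2, hyz]
    have hPN : ∀ y, P (N y) x := by
      intro y
      refine ⟨(hN y).1, fun m hm hh => Nat.find_min (hex y) hm ⟨hh.1, hh.2.trans (hN y).2⟩⟩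
    rw [← hNinj.tsum_eq]
    · refine tsum_congr fun y => ?_
      have hy : φ (N y) x = y := (hN y).2
      have hp := hPN y
      rw [Measure.dirac_apply' _ hS, Set.indicator_apply]
      by_cases h3 : (x, (y : X)) ∈ S
      · rw [if_pos h3, if_pos ⟨hp, by rwa [hy]⟩]; rfl
      · rw [if_neg h3, if_neg (fun h => h3 (hy ▸ h.2))]
    · intro n hn
      have hp : P n x := by
        by_contra hp
        simp [hp] at hn
      refine ⟨⟨φ n x, (hG x _).2 ⟨n, hp.1, rfl⟩⟩, ?_⟩
      refine (Nat.find_eq_iff _).2 ⟨⟨hp.1, rfl⟩, fun m hm hh => hp.2 m hm hh⟩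
  simp_rw [key]
  refine Measurable.tsum fun n => ?_
  have e : MeasurableSet {x | P n x ∧ (x, φ n x) ∈ S} := by
    have hb : ∀ (B : Set X) (hB : MeasurableSet B) (p : Set X), MeasurableSet ((↑) ⁻¹' p : Set B) →
        MeasurableSet (B ∩ p) := by
      intro B hB p hp
      have := (MeasurableEmbedding.subtype_coe hB).measurableSet_image.2 hp
      rwa [Subtype.image_preimage_coe] at this
    have h1 : MeasurableSet (A n ∩ {x | (x, φ n x) ∈ S}) :=
      hb _ (hA n).1 _ ((measurable_subtype_coe.prodMk (hA n).2.1) hS)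
    have h2 : ∀ m, MeasurableSet ((A n ∩ A m) ∩ {x | φ m x = φ n x}) := by
      intro m
      refine hb _ ((hA n).1.inter (hA m).1) _ ?_
      have f1 : Measurable (fun x : (A n ∩ A m : Set X) => φ n x) :=
        (hA n).2.1.comp (measurable_inclusion (Set.inter_subset_left))
      have f2 : Measurable (fun x : (A n ∩ A m : Set X) => φ m x) :=
        (hA m).2.1.comp (measurable_inclusion (Set.inter_subset_right))
      exact measurableSet_eq_fun f2 f1
    have : {x | P n x ∧ (x, φ n x) ∈ S} = (A n ∩ {x | (x, φ n x) ∈ S}) \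
        ⋃ m ∈ Set.Iio n, ((A n ∩ A m) ∩ {x | φ m x = φ n x}) := by
      ext x; simp [P]; tauto
    rw [this]
    exact h1.diff (MeasurableSet.biUnion (Set.to_countable _) fun m _ => h2 m)
  exact Measurable.ite e measurable_const measurable_const

/-- The edge measure has the expected values on measurable sets, for every graphing. -/
theorem edgeMeasure_apply {X : Type*} [MeasurableSpace X] [StandardBorelSpace X] {G : SimpleGraph X}
    {μ : Measure X} (h : IsGraphing G μ) (D : ℕ) {S : Set (X × X)} (hS : MeasurableSet S) :
    edgeMeasure G μ D S = (D : ℝ≥0∞)⁻¹ * ∫⁻ x, ({y | G.Adj x y ∧ (x, y) ∈ S}.encard : ℝ≥0∞) ∂μ := by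
  rw [edgeMeasure, Measure.smul_apply, Measure.bind_apply hS (measurable_sum_dirac_neighborSet h).aemeasurable, smul_eq_mul]
  congr 2
  ext x
  rw [Measure.sum_apply _ hS]
  simp_rw [Measure.dirac_apply' _ hS]
  have := ENNReal.tsum_set_one {y | G.Adj x y ∧ (x, y) ∈ S}
  rw [← this, tsum_subtype (G.neighborSet x) (fun y => S.indicator 1 (x, y)), tsum_subtype _ (fun _ => (1 : ℝ≥0∞))]
  refine tsum_congr fun y => ?_
  by_cases h1 : G.Adj x y <;> by_cases h2 : (x, y) ∈ S <;> simp [Set.indicator, h1, h2]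

/-- The function `f` on directed edges is a circulation (up to null sets) on the `D`-regular
graphing `G`: it is antisymmetric, and its values on the edges starting at a vertex sum to `0`. -/
def IsCirculation {X : Type*} [MeasurableSpace X] (G : SimpleGraph X) (μ : Measure X) (D : ℕ)
    (f : X × X → ℝ) : Prop :=
  (∀ᵐ e ∂(edgeMeasure G μ D), f e.swap = -f e) ∧
    ∀ᵐ x ∂μ, ∑ᶠ y ∈ G.neighborSet x, f (x, y) = 0

/-- The Schreier graph of an action of the free group on `d` generators: distinct vertices are
adjacent if and only if one of the generators maps one of them to the other. -/
def schreierGraph (d : ℕ) (X : Type*) [MulAction (FreeGroup (Fin d)) X] : SimpleGraph X where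
  Adj x y := x ≠ y ∧ ∃ i : Fin d, FreeGroup.of i • x = y ∨ FreeGroup.of i • y = x
  symm := ⟨fun _ _ h => ⟨h.1.symm, h.2.imp fun _ => Or.symm⟩⟩
  loopless := ⟨fun _ h => h.1 rfl⟩

open Classical in
/-- The circulation given by the `i`-th generator `a`: a unit flow from `x` to `a • x`
for every vertex `x`. -/
noncomputable def generatorCirculation {d : ℕ} {X : Type*} [MulAction (FreeGroup (Fin d)) X]
    (i : Fin d) (e : X × X) : ℝ :=
  (if FreeGroup.of i • e.1 = e.2 then 1 else 0) - (if FreeGroup.of i • e.2 = e.1 then 1 else 0)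

/-! Write a_i for the generators. A circulation f is determined by the functions F_i(x) = f(x, a_i
x), and the vertex condition reads ∑ F_i = ∑ F_i ∘ a_i⁻¹. Hence it is orthogonal to gradients: ∑_j ∫
F_j (h ∘ a_j - h) = 0 for bounded measurable h. The action is built so that its gradients
approximate every vector of functions with 1_U - 1_W in one coordinate i and 0 in the others, for
cylinders U, W of equal length. Then F_i has the same integral over all cylinders of a given length,
so it is constant.

The space is a product of finite digit sets with uniform measure, and the potentials are the digits
themselves. Each a_i is a limit of compositions of finite-depth permutations. Step m serves one task
(i, U, W): it adds 1_U - 1_W to digit m in the i-th generator and does nothing to the others. Where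
the digit would overflow, swapping the prefixes of U and W keeps the map bijective (`shear_shear`).
Overflow has probability O(1 / `radix m`), so almost every point sees finitely many overflows and
the limit exists. Since `radix (m + 1) = radix m ^ 3`, later overflows disturb digit m so rarely
that its gradient is right up to an L² error tending to 0 (`integral_coboundaryError_sq_le`). Every
task recurs infinitely often, which gives `integral_mul_gap_eq_zero`.

The same digits show that the graph is a forest. On a finite set of vertices some late digit has
gradient exactly 1 on one chosen edge and 0 on the other outgoing generator edges
(`ShearTask.hasEdgePotentials`), so no cycle can use that edge. The limit maps are injective only on
a conull set; `exists_freeGroup_action` restricts them to a conull invariant Borel set. -/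

/-- For every finite set of vertices and every edge `b → a i • b` starting in it, there is a
potential on `X` that increases by one along that edge, and is constant along all other edges
`x → a j • x` starting in the finite set. -/
def HasEdgePotentials (d : ℕ) (X : Type*) [MulAction (FreeGroup (Fin d)) X] : Prop :=
  ∀ (F : Finset X) (b : X) (i : Fin d), ∃ h : X → ℤ, ∀ x ∈ F, ∀ j,
    (j = i ∧ x = b → h (FreeGroup.of j • x) - h x = 1) ∧
    (¬ (j = i ∧ x = b) → h (FreeGroup.of j • x) - h x = 0)

/-- The generators of the free group and their inverses. -/
def signedGenerator {d : ℕ} (p : Fin d × Bool) : FreeGroup (Fin d) :=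
  if p.2 then FreeGroup.of p.1 else (FreeGroup.of p.1)⁻¹

/-! ### Regularity and acyclicity from edge potentials -/

namespace HasEdgePotentials

variable {d : ℕ} {X : Type*} [MulAction (FreeGroup (Fin d)) X]

/-- The increments of a potential sum to 0 around a closed path, while a path using the marked edge
exactly once has sum 1. Here the path is a loop; the next two lemmas treat double edges. -/
theorem of_smul_ne_self (H : HasEdgePotentials d X) (i : Fin d) (x : X) :
    FreeGroup.of i • x ≠ x := by
  intro hx
  obtain ⟨h, hh⟩ := H {x} x i
  have := (hh x (by simp) i).1 ⟨rfl, rfl⟩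
  rw [hx] at this
  omega

theorem of_smul_injective (H : HasEdgePotentials d X) {i j : Fin d} {x : X}
    (hx : FreeGroup.of i • x = FreeGroup.of j • x) : i = j := by
  by_contra hij
  obtain ⟨h, hh⟩ := H {x} x i
  have h1 := (hh x (by simp) i).1 ⟨rfl, rfl⟩
  have h2 := (hh x (by simp) j).2 fun h => hij h.1.symm
  rw [hx] at h1
  omega

theorem of_smul_of_smul_ne (H : HasEdgePotentials d X) (i j : Fin d) (x : X) :
    FreeGroup.of j • FreeGroup.of i • x ≠ x := by
  classical
  intro hx
  obtain ⟨h, hh⟩ := H {x, FreeGroup.of i • x} x i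
  have h1 := (hh x (by simp) i).1 ⟨rfl, rfl⟩
  have h2 := (hh (FreeGroup.of i • x) (by simp) j).2 fun h => H.of_smul_ne_self i x h.2
  rw [hx] at h2
  omega

theorem of_inv_smul_injective (H : HasEdgePotentials d X) {i j : Fin d} {x : X}
    (hx : (FreeGroup.of i)⁻¹ • x = (FreeGroup.of j)⁻¹ • x) : i = j := by
  apply H.of_smul_injective (x := (FreeGroup.of i)⁻¹ • x)
  rw [smul_inv_smul, hx, smul_inv_smul]

theorem of_smul_ne_of_inv_smul (H : HasEdgePotentials d X) (i j : Fin d) (x : X) :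
    FreeGroup.of i • x ≠ (FreeGroup.of j)⁻¹ • x := by
  intro hx
  apply H.of_smul_of_smul_ne i j x
  rw [hx, smul_inv_smul]

theorem signedGenerator_smul_injective (H : HasEdgePotentials d X) (x : X) :
    Function.Injective fun p : Fin d × Bool => signedGenerator p • x := by
  rintro ⟨i, a⟩ ⟨j, b⟩ hx
  cases a <;> cases b <;> simp only [signedGenerator, if_true, Bool.false_eq_true, if_false] at hx
  · rw [H.of_inv_smul_injective hx]
  · exact absurd hx.symm (H.of_smul_ne_of_inv_smul _ _ _)
  · exact absurd hx (H.of_smul_ne_of_inv_smul _ _ _)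
  · rw [H.of_smul_injective hx]

theorem adj_iff (H : HasEdgePotentials d X) (x y : X) :
    (schreierGraph d X).Adj x y ↔ ∃ p : Fin d × Bool, signedGenerator p • x = y := by
  constructor
  · rintro ⟨-, i, h | h⟩
    · exact ⟨(i, true), by simpa [signedGenerator] using h⟩
    · exact ⟨(i, false), by simpa [signedGenerator, inv_smul_eq_iff] using h.symm⟩
  · rintro ⟨⟨i, a⟩, h⟩
    cases a <;> simp only [signedGenerator, if_true, Bool.false_eq_true, if_false] at h
    · refine ⟨?_, i, Or.inr ?_⟩
      · rintro rfl
        rw [inv_smul_eq_iff] at h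
        exact H.of_smul_ne_self i x h.symm
      · rw [← h, smul_inv_smul]
    · refine ⟨?_, i, Or.inl h⟩
      rintro rfl
      exact H.of_smul_ne_self i x h

theorem neighborSet_eq (H : HasEdgePotentials d X) (x : X) :
    (schreierGraph d X).neighborSet x =
      Set.range fun p : Fin d × Bool => signedGenerator p • x := by
  ext y
  exact H.adj_iff x y

theorem isRegularGraph (H : HasEdgePotentials d X) :
    IsRegularGraph (schreierGraph d X) (2 * d) := by
  intro x
  rw [H.neighborSet_eq, ← Set.image_univ, (H.signedGenerator_smul_injective x).encard_image]
  simp [mul_comm]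

/-- Mark the first edge of a cycle. The rest of the cycle avoids this edge, so the potential is
constant along it, yet it must change by 1 between its ends. -/
theorem isAcyclic (H : HasEdgePotentials d X) : (schreierGraph d X).IsAcyclic := by
  classical
  intro v c hc
  cases c with
  | nil => exact hc.ne_nil rfl
  | cons hadj p =>
    rename_i v₁
    have hnd := hc.isTrail.edges_nodup
    rw [SimpleGraph.Walk.edges_cons, List.nodup_cons] at hnd
    -- The walk may traverse the edge against its generator, so its tail `b` can be either end.
    obtain ⟨b, i, hb, hbv, hlab⟩ : ∃ (b : X) (i : Fin d), s(v, v₁) = s(b, FreeGroup.of i • b) ∧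
        (b = v ∨ b = v₁) ∧ (b = v → v₁ = FreeGroup.of i • b) ∧
        (b = v₁ → v = FreeGroup.of i • b) := by
      obtain ⟨hne, i, h | h⟩ := hadj
      · exact ⟨v, i, by rw [h], Or.inl rfl, fun _ => h.symm, fun h => (hne h).elim⟩
      · exact ⟨v₁, i, by rw [h, Sym2.eq_swap], Or.inr rfl, fun h => (hne h.symm).elim,
          fun _ => h.symm⟩
    obtain ⟨h, hh⟩ := H (insert v p.support.toFinset) b i
    have hconst : ∀ {x y : X} (q : (schreierGraph d X).Walk x y),
        s(v, v₁) ∉ q.edges → (∀ z ∈ q.support, z ∈ insert v p.support.toFinset) →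
        h x = h y := by
      intro x y q
      induction q with
      | nil => intros; rfl
      | @cons x z y hxz q ih =>
        intro hq hs
        rw [SimpleGraph.Walk.edges_cons, List.mem_cons, not_or] at hq
        rw [← ih hq.2 fun w hw => hs w (by simp [hw])]
        obtain ⟨_, j, hj | hj⟩ := id hxz
        · have := (hh x (hs x (by simp)) j).2 (by
            rintro ⟨rfl, rfl⟩
            exact hq.1 (by rw [hb, hj]))
          rw [hj] at this
          omega
        · have := (hh z (hs z (by simp)) j).2 (by
            rintro ⟨rfl, rfl⟩
            exact hq.1 (by rw [hb, hj, Sym2.eq_swap]))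
          rw [hj] at this
          omega
    have h1 : h v₁ = h v := hconst p hnd.1 fun z hz => by simp [hz]
    have h2 := (hh b (by rcases hbv with rfl | rfl <;> simp) i).1 ⟨rfl, rfl⟩
    rcases hbv with rfl | rfl
    · rw [← hlab.1 rfl] at h2
      omega
    · rw [← hlab.2 rfl] at h2
      omega

theorem isTreeing [MeasurableSpace X] {μ : Measure X} (H : HasEdgePotentials d X)
    (hmp : ∀ g : FreeGroup (Fin d), MeasurePreserving (fun x : X => g • x) μ μ) :
    IsTreeing (schreierGraph d X) μ := by
  classical
  refine ⟨?_, ae_of_all _ fun x => H.isAcyclic.induce _⟩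
  let e : ℕ → Option (Fin d × Bool) := fun n => Encodable.decode n
  have he : ∀ p, e (Encodable.encode p) = some p := Encodable.encodek
  -- Codes that decode to nothing get the empty domain, so the default value `1` contributes no
  -- edge.
  refine ⟨fun n => {_x | (e n).isSome}, fun n x => ((e n).elim 1 signedGenerator) • x, ?_, ?_⟩
  · intro n
    refine ⟨MeasurableSet.const _, (hmp _).measurable.comp measurable_subtype_coe,
      (MulAction.injective _).injOn, fun S _ hS => ?_⟩
    rw [Set.image_smul, ← Set.preimage_smul_inv]
    exact (hmp _).measure_preimage hS.nullMeasurableSet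
  · intro x y
    rw [H.adj_iff]
    constructor
    · rintro ⟨p, hp⟩
      exact ⟨Encodable.encode p, by simp [he], by simpa [he] using hp⟩
    · rintro ⟨n, hn, hy⟩
      obtain ⟨p, hp⟩ := Option.isSome_iff_exists.1 hn
      exact ⟨p, by simpa [hp] using hy⟩

end HasEdgePotentials

/-! ### Circulations in terms of the generators -/

namespace HasEdgePotentials

variable {d : ℕ} {X : Type*} [MulAction (FreeGroup (Fin d)) X]

theorem generatorCirculation_of_smul (H : HasEdgePotentials d X) (i j : Fin d) (x : X) :
    generatorCirculation i (x, FreeGroup.of j • x) = if i = j then 1 else 0 := by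
  rw [generatorCirculation, if_neg (H.of_smul_of_smul_ne j i x), sub_zero]
  by_cases h : i = j
  · simp [h]
  · rw [if_neg h, if_neg fun hx => h (H.of_smul_injective hx)]

theorem generatorCirculation_swap (i : Fin d) (e : X × X) :
    generatorCirculation i e.swap = -generatorCirculation i e := by
  simp [generatorCirculation]

theorem generatorCirculation_inv_smul (H : HasEdgePotentials d X) (i j : Fin d) (x : X) :
    generatorCirculation i (x, (FreeGroup.of j)⁻¹ • x) = if i = j then -1 else 0 := by
  have h1 := H.generatorCirculation_of_smul i j ((FreeGroup.of j)⁻¹ • x)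
  rw [smul_inv_smul] at h1
  have h2 := generatorCirculation_swap i ((FreeGroup.of j)⁻¹ • x, x)
  rw [Prod.swap_prod_mk, h1] at h2
  rw [h2]
  split_ifs <;> simp

theorem finsum_neighborSet (H : HasEdgePotentials d X) (x : X) (φ : X → ℝ) :
    ∑ᶠ y ∈ (schreierGraph d X).neighborSet x, φ y =
      ∑ i : Fin d, φ (FreeGroup.of i • x) + ∑ i : Fin d, φ ((FreeGroup.of i)⁻¹ • x) := by
  rw [H.neighborSet_eq, finsum_mem_range (H.signedGenerator_smul_injective x),
    finsum_eq_sum_of_fintype (fun p : Fin d × Bool => φ (signedGenerator p • x)),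
    Fintype.sum_prod_type]
  simp [signedGenerator, Finset.sum_add_distrib]

variable [MeasurableSpace X] [StandardBorelSpace X] {μ : Measure X}

theorem edgeMeasure_eq (H : HasEdgePotentials d X)
    (hmp : ∀ g : FreeGroup (Fin d), MeasurePreserving (fun x : X => g • x) μ μ) (D : ℕ) :
    edgeMeasure (schreierGraph d X) μ D = (D : ℝ≥0∞)⁻¹ •
      Measure.sum fun p : Fin d × Bool => μ.map fun x => (x, signedGenerator p • x) := by
  have hmeas : ∀ p : Fin d × Bool, Measurable fun x : X => (x, signedGenerator p • x) :=
    fun p => measurable_id.prodMk (hmp _).measurable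
  rw [edgeMeasure]
  congr 1
  ext S hS
  rw [Measure.bind_apply hS
    (measurable_sum_dirac_neighborSet (H.isTreeing hmp).1).aemeasurable, Measure.sum_apply _ hS]
  have key : ∀ x, (Measure.sum fun y : (schreierGraph d X).neighborSet x =>
      Measure.dirac (x, (y : X))) S =
      ∑' p : Fin d × Bool, ((fun x => (x, signedGenerator p • x)) ⁻¹' S).indicator 1 x := by
    intro x
    rw [Measure.sum_apply _ hS]
    let e : Fin d × Bool ≃ (schreierGraph d X).neighborSet x :=
      (Equiv.ofInjective _ (H.signedGenerator_smul_injective x)).trans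
        (Equiv.setCongr (H.neighborSet_eq x).symm)
    rw [← e.tsum_eq]
    refine tsum_congr fun p => ?_
    rw [Measure.dirac_apply' _ hS]
    rfl
  simp_rw [key]
  rw [lintegral_tsum fun p =>
    (measurable_one.indicator (hmeas p hS)).aemeasurable]
  refine tsum_congr fun p => ?_
  rw [lintegral_indicator_one (hmeas p hS), Measure.map_apply (hmeas p) hS]

/-- The map `x ↦ (x, g • x)` is Borel and injective, hence a measurable embedding, so `P` need not
be measurable. -/
theorem ae_edgeMeasure_iff (H : HasEdgePotentials d X)
    (hmp : ∀ g : FreeGroup (Fin d), MeasurePreserving (fun x : X => g • x) μ μ) (D : ℕ)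
    {P : X × X → Prop} :
    (∀ᵐ e ∂edgeMeasure (schreierGraph d X) μ D, P e) ↔
      ∀ p : Fin d × Bool, ∀ᵐ x ∂μ, P (x, signedGenerator p • x) := by
  rw [H.edgeMeasure_eq hmp, Measure.ae_ennreal_smul_measure_iff (by simp), Measure.ae_sum_iff]
  refine forall_congr' fun p => ?_
  refine MeasurableEmbedding.ae_map_iff (Measurable.measurableEmbedding
    (measurable_id.prodMk (hmp _).measurable) fun x y h => ?_)
  exact congrArg Prod.fst h

theorem memLp_comp_smul (H : HasEdgePotentials d X)
    (hmp : ∀ g : FreeGroup (Fin d), MeasurePreserving (fun x : X => g • x) μ μ) {D : ℕ}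
    (hD : D ≠ 0) {f : X × X → ℝ} (hf : MemLp f 2 (edgeMeasure (schreierGraph d X) μ D)) (i : Fin d) :
    MemLp (fun x => f (x, FreeGroup.of i • x)) 2 μ := by
  have hmeas : Measurable fun x : X => (x, FreeGroup.of i • x) :=
    measurable_id.prodMk (hmp _).measurable
  rw [H.edgeMeasure_eq hmp] at hf
  have h1 := hf.smul_measure (c := (D : ℝ≥0∞)) (by simp)
  rw [smul_smul, ENNReal.mul_inv_cancel (by simpa using hD) (by simp), one_smul] at h1
  have h2 : MemLp f 2 (μ.map fun x => (x, FreeGroup.of i • x)) :=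
    h1.mono_measure (Measure.le_sum
      (fun p : Fin d × Bool => μ.map fun x => (x, signedGenerator p • x)) (i, true))
  exact h2.comp_measurePreserving ⟨hmeas, rfl⟩

/-- Antisymmetry expresses the incoming edges by the outgoing ones, which turns the vertex condition
into the hypothesis of the rigidity assumption `hrig`. -/
theorem isCirculation_iff (H : HasEdgePotentials d X)
    (hmp : ∀ g : FreeGroup (Fin d), MeasurePreserving (fun x : X => g • x) μ μ)
    (hrig : ∀ F : Fin d → X → ℝ, (∀ i, MemLp (F i) 2 μ) →
      (∀ᵐ x ∂μ, ∑ i, F i x = ∑ i, F i ((FreeGroup.of i)⁻¹ • x)) →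
      ∃ c : Fin d → ℝ, ∀ i, ∀ᵐ x ∂μ, F i x = c i) {D : ℕ} (hD : D ≠ 0)
    {f : X × X → ℝ} (hf : MemLp f 2 (edgeMeasure (schreierGraph d X) μ D)) :
    IsCirculation (schreierGraph d X) μ D f ↔
      ∃ c : Fin d → ℝ, f =ᵐ[edgeMeasure (schreierGraph d X) μ D]
        fun e => ∑ i, c i * generatorCirculation i e := by
  have hinv : ∀ (P : X → Prop) (g : FreeGroup (Fin d)), (∀ᵐ x ∂μ, P x) → ∀ᵐ x ∂μ, P (g • x) :=
    fun P g h => (hmp g).quasiMeasurePreserving.ae h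
  constructor
  · rintro ⟨hanti, hsum⟩
    rw [H.ae_edgeMeasure_iff hmp] at hanti
    have h1 : ∀ᵐ x ∂μ, ∀ i : Fin d, f (x, (FreeGroup.of i)⁻¹ • x) =
        -f ((FreeGroup.of i)⁻¹ • x, x) := by
      refine ae_all_iff.2 fun i => ?_
      filter_upwards [hanti (i, false)] with x hx
      simp only [signedGenerator, Bool.false_eq_true, if_false, Prod.swap_prod_mk] at hx
      linarith
    obtain ⟨c, hc⟩ := hrig (fun i x => f (x, FreeGroup.of i • x)) (H.memLp_comp_smul hmp hD hf) (by
      filter_upwards [h1, hsum] with x hx hs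
      rw [H.finsum_neighborSet x fun y => f (x, y)] at hs
      simp_rw [hx, Finset.sum_neg_distrib] at hs
      simp_rw [smul_inv_smul]
      linarith)
    refine ⟨c, (H.ae_edgeMeasure_iff hmp D).2 ?_⟩
    rintro ⟨j, b⟩
    cases b
    · filter_upwards [h1, hinv _ (FreeGroup.of j)⁻¹ (hc j)] with x hx hcx
      simp only [smul_inv_smul] at hcx
      simp [signedGenerator, H.generatorCirculation_inv_smul, hx, hcx]
    · filter_upwards [hc j] with x hx
      simp [signedGenerator, H.generatorCirculation_of_smul, hx]
  · rintro ⟨c, hc⟩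
    have hc' := (H.ae_edgeMeasure_iff hmp D).1 hc
    have hp : ∀ j, ∀ᵐ x ∂μ, f (x, FreeGroup.of j • x) = c j := fun j => by
      filter_upwards [hc' (j, true)] with x hx
      simpa [signedGenerator, H.generatorCirculation_of_smul] using hx
    have hn : ∀ j, ∀ᵐ x ∂μ, f (x, (FreeGroup.of j)⁻¹ • x) = -c j := fun j => by
      filter_upwards [hc' (j, false)] with x hx
      simpa [signedGenerator, H.generatorCirculation_inv_smul] using hx
    constructor
    · rw [H.ae_edgeMeasure_iff hmp]
      rintro ⟨j, b⟩
      cases b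
      · filter_upwards [hn j, hinv _ (FreeGroup.of j)⁻¹ (hp j)] with x h1 h2
        simp only [smul_inv_smul] at h2
        simp [signedGenerator, h1, h2]
      · filter_upwards [hp j, hinv _ (FreeGroup.of j) (hn j)] with x h1 h2
        simp only [inv_smul_smul] at h2
        simp [signedGenerator, h1, h2]
    · filter_upwards [ae_all_iff.2 hp, ae_all_iff.2 hn] with x h1 h2
      rw [H.finsum_neighborSet x fun y => f (x, y)]
      simp [h1, h2]

end HasEdgePotentials

/-! ### Digit expansions and shears -/

/-- The size of the `k`-th digit of a mixed radix expansion. -/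
def radix (k : ℕ) : ℕ := 2 ^ 3 ^ k

theorem one_le_radix (k : ℕ) : 1 ≤ radix k := Nat.one_le_two_pow

instance (k : ℕ) : NeZero (radix k) := ⟨Nat.one_le_iff_ne_zero.1 (one_le_radix k)⟩

/-- Infinite mixed radix expansions. -/
abbrev Digits : Type := ∀ k : ℕ, Fin (radix k)

/-- Finite mixed radix expansions of length `k`. -/
abbrev Prefix (k : ℕ) : Type := ∀ j : Fin k, Fin (radix j)

namespace Digits

/-- The first `k` digits. -/
def pre (k : ℕ) (x : Digits) : Prefix k := fun j => x j

theorem pre_eq_iff {k : ℕ} {x y : Digits} : pre k x = pre k y ↔ ∀ j < k, x j = y j :=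
  ⟨fun h j hj => congrFun h ⟨j, hj⟩, fun h => funext fun j => h j j.2⟩

theorem pre_eq_of_le {k n : ℕ} (hkn : k ≤ n) {x y : Digits} (h : pre n x = pre n y) :
    pre k x = pre k y :=
  pre_eq_iff.2 fun j hj => pre_eq_iff.1 h j (hj.trans_le hkn)

/-- Replace the first `k` digits of `x` by `u`. -/
def overwrite {k : ℕ} (u : Prefix k) (x : Digits) : Digits :=
  fun j => if h : j < k then u ⟨j, h⟩ else x j

theorem overwrite_of_le {k j : ℕ} (u : Prefix k) (x : Digits) (h : k ≤ j) :
    overwrite u x j = x j := dif_neg h.not_gt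

@[simp]
theorem pre_overwrite {k : ℕ} (u : Prefix k) (x : Digits) : pre k (overwrite u x) = u := by
  ext j
  simp [pre, overwrite]

@[simp]
theorem overwrite_overwrite {k : ℕ} (u w : Prefix k) (x : Digits) :
    overwrite u (overwrite w x) = overwrite u x := by
  funext j
  by_cases h : j < k <;> simp [overwrite, h]

@[simp]
theorem overwrite_pre {k : ℕ} (x : Digits) : overwrite (pre k x) x = x := by
  funext j
  by_cases h : j < k <;> simp [overwrite, pre, h]

theorem pre_overwrite_congr {k n : ℕ} (u : Prefix k) {x y : Digits} (h : pre n x = pre n y) :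
    pre n (overwrite u x) = pre n (overwrite u y) := by
  refine pre_eq_iff.2 fun j hj => ?_
  by_cases hk : j < k
  · simp [overwrite, hk]
  · simp [overwrite, hk, pre_eq_iff.1 h j hj]

/-- Swap the prefixes `u` and `w`. -/
def swapPre {k : ℕ} (u w : Prefix k) (x : Digits) : Digits :=
  if pre k x = u then overwrite w x else if pre k x = w then overwrite u x else x

/-- The difference of the indicator functions of the sets of expansions starting with `u` and
with `w`. -/
def gap {k : ℕ} (u w : Prefix k) (x : Digits) : ℤ :=
  (if pre k x = u then 1 else 0) - (if pre k x = w then 1 else 0)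

theorem gap_congr {k : ℕ} (u w : Prefix k) {x y : Digits} (h : pre k x = pre k y) :
    gap u w x = gap u w y := by simp [gap, h]

theorem gap_swap {k : ℕ} (u w : Prefix k) (x : Digits) : gap w u x = -gap u w x := by
  simp [gap]

theorem abs_gap_le {k : ℕ} (u w : Prefix k) (x : Digits) : |gap u w x| ≤ 1 := by
  unfold gap
  split_ifs <;> simp

theorem swapPre_of_le {k j : ℕ} (u w : Prefix k) (x : Digits) (h : k ≤ j) :
    swapPre u w x j = x j := by
  unfold swapPre
  split_ifs <;> simp [overwrite_of_le _ _ h]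

theorem swapPre_swapPre {k : ℕ} (u w : Prefix k) (x : Digits) :
    swapPre w u (swapPre u w x) = x := by
  by_cases hu : pre k x = u
  · subst hu
    simp [swapPre]
  · by_cases hw : pre k x = w
    · subst hw
      simp [swapPre, hu, Ne.symm hu]
    · simp [swapPre, hu, hw]

theorem gap_swapPre {k : ℕ} (u w : Prefix k) (x : Digits) :
    gap u w (swapPre u w x) = -gap u w x := by
  by_cases hu : pre k x = u
  · subst hu
    simp [swapPre, gap, eq_comm]
  · by_cases hw : pre k x = w
    · subst hw
      simp [swapPre, hu, gap, Ne.symm hu]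
    · simp [swapPre, hu, hw, gap]

theorem pre_swapPre_congr {k n : ℕ} (hkn : k ≤ n) (u w : Prefix k) {x y : Digits}
    (h : pre n x = pre n y) : pre n (swapPre u w x) = pre n (swapPre u w y) := by
  have hk := pre_eq_of_le hkn h
  unfold swapPre
  rw [hk]
  split_ifs
  · exact pre_overwrite_congr _ h
  · exact pre_overwrite_congr _ h
  · exact h

/-- Add the function `gap u w` to the `m`-th digit where this does not lead out of the range of
digits, and swap the prefixes `u` and `w` elsewhere. -/
def shear (m : ℕ) {k : ℕ} (u w : Prefix k) (x : Digits) : Digits :=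
  if h : 0 ≤ (x m : ℤ) + gap u w x ∧ (x m : ℤ) + gap u w x < radix m then
    Function.update x m ⟨((x m : ℤ) + gap u w x).toNat, by omega⟩
  else swapPre u w x

theorem shear_of_gt {m k : ℕ} (hk : k ≤ m) (u w : Prefix k) (x : Digits) {j : ℕ} (hj : m < j) :
    shear m u w x j = x j := by
  unfold shear
  split_ifs
  · exact Function.update_of_ne hj.ne' _ _
  · exact swapPre_of_le _ _ _ (hk.trans hj.le)

theorem shear_of_lt {m k : ℕ} {u w : Prefix k} {x : Digits}
    (h : 0 ≤ (x m : ℤ) + gap u w x ∧ (x m : ℤ) + gap u w x < radix m) {j : ℕ} (hj : j < m) :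
    shear m u w x j = x j := by
  rw [shear, dif_pos h]
  exact Function.update_of_ne hj.ne _ _

theorem shear_self {m k : ℕ} {u w : Prefix k} {x : Digits}
    (h : 0 ≤ (x m : ℤ) + gap u w x ∧ (x m : ℤ) + gap u w x < radix m) :
    (shear m u w x m : ℤ) = x m + gap u w x := by
  rw [shear, dif_pos h, Function.update_self]
  simp [h.1]

theorem shear_self_of_not {m k : ℕ} (hk : k ≤ m) {u w : Prefix k} {x : Digits}
    (h : ¬(0 ≤ (x m : ℤ) + gap u w x ∧ (x m : ℤ) + gap u w x < radix m)) :
    shear m u w x m = x m := by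
  rw [shear, dif_neg h]
  exact swapPre_of_le _ _ _ hk

/-- Adding 1 over `u` leaves the top digit without an image and digit 0 uncovered; over `w` it is
the reverse. The swap sends (`u`, top) to (`w`, top) and (`w`, 0) to (`u`, 0), filling exactly these
holes. Since `gap` survives the addition and changes sign under the swap, the inverse shear takes
the same branch. -/
theorem shear_shear {m k : ℕ} (hk : k ≤ m) (u w : Prefix k) (x : Digits) :
    shear m w u (shear m u w x) = x := by
  by_cases h : 0 ≤ (x m : ℤ) + gap u w x ∧ (x m : ℤ) + gap u w x < radix m
  · have hg : gap u w (shear m u w x) = gap u w x :=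
      gap_congr _ _ (pre_eq_iff.2 fun j hj => shear_of_lt h (hj.trans_le hk))
    have hs := shear_self h
    have h' : 0 ≤ (shear m u w x m : ℤ) + gap w u (shear m u w x) ∧
        (shear m u w x m : ℤ) + gap w u (shear m u w x) < radix m := by
      rw [gap_swap, hg, hs]
      omega
    funext j
    rcases lt_trichotomy j m with hj | rfl | hj
    · rw [shear_of_lt h' hj, shear_of_lt h hj]
    · have := shear_self h'
      rw [gap_swap, hg, hs] at this
      apply Fin.ext
      omega
    · rw [shear_of_gt hk _ _ _ hj, shear_of_gt hk _ _ _ hj]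
  · have hs : shear m u w x = swapPre u w x := dif_neg h
    have hm : shear m u w x m = x m := shear_self_of_not hk h
    have h' : ¬(0 ≤ (shear m u w x m : ℤ) + gap w u (shear m u w x) ∧
        (shear m u w x m : ℤ) + gap w u (shear m u w x) < radix m) := by
      rwa [hm, hs, gap_swap, gap_swapPre, neg_neg]
    rw [shear, dif_neg h', hs, swapPre_swapPre]

theorem pre_shear_congr {m k n : ℕ} (hk : k ≤ m) (hn : m < n) (u w : Prefix k) {x y : Digits}
    (h : pre n x = pre n y) : pre n (shear m u w x) = pre n (shear m u w y) := by
  have hg := gap_congr u w (pre_eq_of_le (hk.trans hn.le) h)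
  have hm := pre_eq_iff.1 h m hn
  by_cases hx : 0 ≤ (x m : ℤ) + gap u w x ∧ (x m : ℤ) + gap u w x < radix m
  · have hy : 0 ≤ (y m : ℤ) + gap u w y ∧ (y m : ℤ) + gap u w y < radix m := by
      rwa [← hg, ← hm]
    refine pre_eq_iff.2 fun j hj => ?_
    rcases lt_trichotomy j m with hjm | rfl | hjm
    · rw [shear_of_lt hx hjm, shear_of_lt hy hjm, pre_eq_iff.1 h j hj]
    · have h1 := shear_self hx
      have h2 := shear_self hy
      apply Fin.ext
      have : ((x j : ℕ) : ℤ) = y j := by rw [hm]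
      omega
    · rw [shear_of_gt hk _ _ _ hjm, shear_of_gt hk _ _ _ hjm, pre_eq_iff.1 h j hj]
  · have hy : ¬(0 ≤ (y m : ℤ) + gap u w y ∧ (y m : ℤ) + gap u w y < radix m) := by
      rwa [← hg, ← hm]
    rw [shear, dif_neg hx, shear, dif_neg hy]
    exact pre_swapPre_congr (hk.trans hn.le) _ _ h

/-- A permutation of expansions that induces permutations of the prefixes of length `n` for all
`n ≥ m`. -/
def IsLocal (m : ℕ) (R : Equiv.Perm Digits) : Prop :=
  ∀ n, m ≤ n → ∀ x y, pre n (R x) = pre n (R y) ↔ pre n x = pre n y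

theorem isLocal_one (m : ℕ) : IsLocal m 1 := fun _ _ _ _ => Iff.rfl

theorem IsLocal.mono {m m' : ℕ} (h : m ≤ m') {R : Equiv.Perm Digits} (hR : IsLocal m R) :
    IsLocal m' R := fun n hn => hR n (h.trans hn)

theorem IsLocal.mul {m : ℕ} {R S : Equiv.Perm Digits} (hR : IsLocal m R) (hS : IsLocal m S) :
    IsLocal m (R * S) := fun n hn x y => (hR n hn _ _).trans (hS n hn x y)

/-- The permutation `shear m u w`. -/
def shearPerm {m k : ℕ} (hk : k ≤ m) (u w : Prefix k) : Equiv.Perm Digits where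
  toFun := shear m u w
  invFun := shear m w u
  left_inv := shear_shear hk u w
  right_inv := shear_shear hk w u

theorem isLocal_shearPerm {m k : ℕ} (hk : k ≤ m) (u w : Prefix k) :
    IsLocal (m + 1) (shearPerm hk u w) := fun n hn x y =>
  ⟨fun h => by
    have := pre_shear_congr hk hn w u h
    rwa [show shear m w u (shearPerm hk u w x) = x from shear_shear hk u w x,
      show shear m w u (shearPerm hk u w y) = y from shear_shear hk u w y] at this,
    pre_shear_congr hk hn u w⟩

end Digits

/-! ### The generators as limits of finite stages -/

/-- A generator together with two prefixes of the same length. -/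
abbrev ShearTask (d : ℕ) : Type := Fin d × Σ k : ℕ, Prefix k × Prefix k

namespace ShearTask

open Digits

variable {d : ℕ} (e : ℕ → ShearTask d) (i : Fin d)

/-- The permutation performed at step `m` to modify the `i`-th generator. -/
def stage (m : ℕ) : Equiv.Perm Digits :=
  if h : (e m).1 = i ∧ (e m).2.1 ≤ m then shearPerm h.2 (e m).2.2.1 (e m).2.2.2 else 1

/-- The amount that `stage` intends to add to the `m`-th digit. -/
def stageGap (m : ℕ) (x : Digits) : ℤ :=
  if (e m).1 = i ∧ (e m).2.1 ≤ m then gap (e m).2.2.1 (e m).2.2.2 x else 0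

/-- The set where `stage` cannot add the intended amount to the `m`-th digit. -/
def bad (m : ℕ) : Set Digits :=
  {x | ¬(0 ≤ (x m : ℤ) + stageGap e i m x ∧ (x m : ℤ) + stageGap e i m x < radix m)}

/-- The composition of the first `m` stages. -/
def approx : ℕ → Equiv.Perm Digits
  | 0 => 1
  | m + 1 => approx m * stage e i m

theorem abs_stageGap_le (m : ℕ) (x : Digits) : |stageGap e i m x| ≤ 1 := by
  unfold stageGap
  split_ifs
  · exact abs_gap_le _ _ _
  · simp

theorem isLocal_stage (m : ℕ) : IsLocal (m + 1) (stage e i m) := by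
  unfold stage
  split_ifs
  · exact isLocal_shearPerm _ _ _
  · exact isLocal_one _

theorem isLocal_approx (m : ℕ) : IsLocal m (approx e i m) := by
  induction m with
  | zero => exact isLocal_one _
  | succ m ih => exact (ih.mono m.le_succ).mul (isLocal_stage e i m)

theorem stage_of_gt (m : ℕ) (x : Digits) {j : ℕ} (hj : m < j) : stage e i m x j = x j := by
  unfold stage
  split_ifs with h
  · exact shear_of_gt h.2 _ _ _ hj
  · rfl

theorem approx_of_le (m : ℕ) (x : Digits) {j : ℕ} (hj : m ≤ j) : approx e i m x j = x j := by
  induction m generalizing x with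
  | zero => rfl
  | succ m ih =>
    rw [approx, Equiv.Perm.mul_apply, ih _ (m.le_succ.trans hj), stage_of_gt _ _ _ _ hj]

variable {e i}

theorem pre_stage {m : ℕ} {x : Digits} (hx : x ∉ bad e i m) :
    pre m (stage e i m x) = pre m x := by
  simp only [bad, Set.mem_ofPred_eq, not_not, stageGap] at hx
  refine pre_eq_iff.2 fun j hj => ?_
  unfold stage
  split_ifs at hx ⊢ with h
  · exact shear_of_lt hx hj
  · rfl

theorem stage_self {m : ℕ} {x : Digits} (hx : x ∉ bad e i m) :
    (stage e i m x m : ℤ) = x m + stageGap e i m x := by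
  simp only [bad, Set.mem_ofPred_eq, not_not, stageGap] at hx
  unfold stage stageGap
  split_ifs at hx ⊢ with h
  · exact shear_self hx
  · simp

theorem stage_self_of_mem {m : ℕ} {x : Digits} (hx : x ∈ bad e i m) :
    stage e i m x m = x m := by
  simp only [bad, Set.mem_ofPred_eq, stageGap] at hx
  unfold stage
  split_ifs at hx ⊢ with h
  · exact shear_self_of_not h.2 hx
  · rfl

/-- The new stage acts before the older ones, and those only change digits below `m`. -/
theorem approx_succ_self (m : ℕ) (x : Digits) :
    approx e i (m + 1) x m = stage e i m x m := by
  rw [approx, Equiv.Perm.mul_apply, approx_of_le _ _ _ _ le_rfl]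

/-- Off `bad`, stage `n` fixes the first `n` digits, and these determine the first `n` digits of the
image under the earlier stages. So the prefixes stabilise. -/
theorem pre_approx {m n : ℕ} (hmn : m ≤ n) {x : Digits} (hx : ∀ l, m ≤ l → x ∉ bad e i l) :
    pre m (approx e i n x) = pre m (approx e i m x) := by
  induction n, hmn using Nat.le_induction with
  | base => rfl
  | succ n hmn ih =>
    rw [← ih, approx, Equiv.Perm.mul_apply]
    exact pre_eq_of_le hmn ((isLocal_approx e i n n le_rfl _ _).2 (pre_stage (hx n hmn)))

variable (e i) in
/-- The expansions that are in only finitely many of the sets `bad`. -/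
def good : Set Digits := {x | ∃ K, ∀ m, K ≤ m → x ∉ bad e i m}

open Classical in
variable (e i) in
/-- The limit of the permutations `approx`. -/
noncomputable def limitMap (x : Digits) : Digits :=
  if h : ∃ K, ∀ m, K ≤ m → x ∉ bad e i m then
    fun j => approx e i (max (Nat.find h) (j + 1)) x j
  else x

theorem pre_limitMap {m : ℕ} {x : Digits} (hx : ∀ l, m ≤ l → x ∉ bad e i l) :
    pre m (limitMap e i x) = pre m (approx e i m x) := by
  classical
  have h : ∃ K, ∀ m, K ≤ m → x ∉ bad e i m := ⟨m, hx⟩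
  refine pre_eq_iff.2 fun j hj => ?_
  rw [limitMap, dif_pos h]
  refine (pre_eq_iff.1 (pre_approx (m := max (Nat.find h) (j + 1)) (n := m) ?_ ?_) j ?_).symm
  · exact max_le (Nat.find_min' h hx) hj
  · exact fun l hl => Nat.find_spec h l ((le_max_left _ _).trans hl)
  · exact lt_max_of_lt_right j.lt_succ_self

theorem limitMap_sub {m : ℕ} {x : Digits} (hx : ∀ l, m ≤ l → x ∉ bad e i l) :
    (limitMap e i x m : ℤ) - x m = stageGap e i m x := by
  rw [pre_eq_iff.1 (pre_limitMap fun l hl => hx l (m.le_succ.trans hl)) m m.lt_succ_self,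
    approx_succ_self, stage_self (hx m le_rfl)]
  ring

theorem limitMap_of_mem_bad {m : ℕ} {x : Digits} (hx : ∀ l, m < l → x ∉ bad e i l)
    (hm : x ∈ bad e i m) : limitMap e i x m = x m := by
  rw [pre_eq_iff.1 (pre_limitMap hx) m m.lt_succ_self, approx_succ_self, stage_self_of_mem hm]

/-- At every large depth the limit agrees on both points with one permutation of prefixes. -/
theorem limitMap_injOn : Set.InjOn (limitMap e i) (good e i) := by
  rintro x ⟨K, hK⟩ y ⟨L, hL⟩ hxy
  funext j
  let n := max (max K L) (j + 1)
  have h1 : pre n (limitMap e i x) = pre n (approx e i n x) :=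
    pre_limitMap fun l hl => hK l (by omega)
  have h2 : pre n (limitMap e i y) = pre n (approx e i n y) :=
    pre_limitMap fun l hl => hL l (by omega)
  rw [hxy, h2] at h1
  exact pre_eq_iff.1 ((isLocal_approx e i n n le_rfl _ _).1 h1.symm) j (by omega)

end ShearTask

/-! ### The uniform measure and local permutations -/

namespace Digits

/-- The uniform measure on expansions. -/
noncomputable def uniformMeasure : Measure Digits :=
  Measure.infinitePi fun k => (PMF.uniformOfFintype (Fin (radix k))).toMeasure

instance : IsProbabilityMeasure uniformMeasure := by
  unfold uniformMeasure
  infer_instance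

theorem measurable_pre (k : ℕ) : Measurable (pre k) :=
  measurable_pi_lambda _ fun j => measurable_pi_apply (j : ℕ)

theorem measurableSet_pre_eq (k : ℕ) (v : Prefix k) : MeasurableSet {x | pre k x = v} :=
  measurable_pre k (measurableSet_singleton v)

theorem uniformMeasure_digit_eq (k : ℕ) (a : Fin (radix k)) :
    uniformMeasure {x | x k = a} = (radix k : ℝ≥0∞)⁻¹ := by
  have h := measurePreserving_eval_infinitePi
    (fun k => (PMF.uniformOfFintype (Fin (radix k))).toMeasure) k
  have h1 := h.measure_preimage (measurableSet_singleton a).nullMeasurableSet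
  rw [PMF.toMeasure_apply_singleton _ _ (measurableSet_singleton a),
    PMF.uniformOfFintype_apply, Fintype.card_fin] at h1
  exact h1

theorem uniformMeasure_pre_eq (k : ℕ) (v : Prefix k) :
    uniformMeasure {x | pre k x = v} = ∏ j ∈ Finset.range k, (radix j : ℝ≥0∞)⁻¹ := by
  have h1 : {x | pre k x = v} =
      (Finset.range k : Set ℕ).pi fun j => {overwrite v (fun _ => 0) j} := by
    ext x
    rw [Set.mem_ofPred_eq, ← pre_overwrite v (fun _ => 0), pre_eq_iff]
    simp [Set.mem_pi]
  rw [h1, uniformMeasure, Measure.infinitePi_pi _ fun _ _ => measurableSet_singleton _]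
  refine Finset.prod_congr rfl fun j _ => ?_
  rw [PMF.toMeasure_apply_singleton _ _ (measurableSet_singleton _),
    PMF.uniformOfFintype_apply, Fintype.card_fin]

/-- The sets of expansions with a given prefix of length at least `m`. -/
def cylinders (m : ℕ) : Set (Set Digits) := {s | ∃ n, m ≤ n ∧ ∃ z, s = {x | pre n x = pre n z}}

theorem isPiSystem_cylinders (m : ℕ) : IsPiSystem (cylinders m) := by
  rintro _ ⟨n, hn, z, rfl⟩ _ ⟨n', -, z', rfl⟩ ⟨p, hp, hp'⟩
  refine ⟨max n n', hn.trans (le_max_left _ _), p, ?_⟩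
  ext x
  constructor
  · rintro ⟨hx, hx'⟩
    have h1 := pre_eq_iff.1 (hx.trans hp.symm)
    have h2 := pre_eq_iff.1 (hx'.trans hp'.symm)
    refine pre_eq_iff.2 fun j hj => ?_
    rcases lt_max_iff.1 hj with h | h
    exacts [h1 j h, h2 j h]
  · exact fun hx => ⟨(pre_eq_of_le (le_max_left _ _) hx).trans hp,
      (pre_eq_of_le (le_max_right _ _) hx).trans hp'⟩

theorem generateFrom_cylinders (m : ℕ) :
    (inferInstance : MeasurableSpace Digits) = MeasurableSpace.generateFrom (cylinders m) := by
  apply le_antisymm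
  · refine iSup_le fun j => ?_
    rw [← measurable_iff_comap_le]
    refine @measurable_to_countable' _ _ _ _ (MeasurableSpace.generateFrom (cylinders m)) _
      fun a => ?_
    have hj : j < max m (j + 1) := by omega
    have : (fun x : Digits => x j) ⁻¹' {a} =
        ⋃ v ∈ {v : Prefix (max m (j + 1)) | v ⟨j, hj⟩ = a},
          {x | pre (max m (j + 1)) x = pre (max m (j + 1)) (overwrite v fun _ => 0)} := by
      ext x
      simp [pre]
    rw [this]
    exact MeasurableSet.biUnion (Set.to_countable _) fun v _ =>
      MeasurableSpace.measurableSet_generateFrom ⟨_, le_max_left _ _, _, rfl⟩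
  · refine MeasurableSpace.generateFrom_le ?_
    rintro _ ⟨n, -, z, rfl⟩
    exact measurableSet_pre_eq _ _

theorem IsLocal.preimage {m n : ℕ} (hn : m ≤ n) {R : Equiv.Perm Digits} (hR : IsLocal m R)
    (z : Digits) : R ⁻¹' {x | pre n x = pre n z} = {x | pre n x = pre n (R.symm z)} := by
  ext x
  have := hR n hn x (R.symm z)
  rwa [Equiv.apply_symm_apply] at this

theorem IsLocal.measurable {m : ℕ} {R : Equiv.Perm Digits} (hR : IsLocal m R) : Measurable R := by
  have : @Measurable _ _ _ (MeasurableSpace.generateFrom (cylinders m)) R := by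
    refine measurable_generateFrom ?_
    rintro _ ⟨n, hn, z, rfl⟩
    rw [hR.preimage hn]
    exact measurableSet_pre_eq _ _
  rwa [← generateFrom_cylinders m] at this

theorem measurePreserving_of_cylinders (m : ℕ) {T : Digits → Digits} (hT : Measurable T)
    (h : ∀ n, m ≤ n → ∀ z, uniformMeasure (T ⁻¹' {x | pre n x = pre n z}) =
      uniformMeasure {x | pre n x = pre n z}) :
    MeasurePreserving T uniformMeasure uniformMeasure := by
  refine ⟨hT, ?_⟩
  have : IsProbabilityMeasure (uniformMeasure.map T) :=
    Measure.isProbabilityMeasure_map hT.aemeasurable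
  refine ext_of_generate_finite _ (generateFrom_cylinders m) (isPiSystem_cylinders m) ?_ (by simp)
  rintro _ ⟨n, hn, z, rfl⟩
  rw [Measure.map_apply hT (measurableSet_pre_eq _ _), h n hn]

/-- Preimages of long cylinders are cylinders of the same length, and the measure of a cylinder
depends only on its length. -/
theorem IsLocal.measurePreserving {m : ℕ} {R : Equiv.Perm Digits} (hR : IsLocal m R) :
    MeasurePreserving R uniformMeasure uniformMeasure := by
  refine measurePreserving_of_cylinders m hR.measurable fun n hn z => ?_
  rw [hR.preimage hn, uniformMeasure_pre_eq, uniformMeasure_pre_eq]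

end Digits

/-! ### Convergence of the stages and the L² error -/

namespace ShearTask

open Digits Filter
open scoped Topology

variable {d : ℕ} (e : ℕ → ShearTask d) (i : Fin d)

theorem measurable_stageGap (m : ℕ) : Measurable (stageGap e i m) := by
  unfold stageGap
  split_ifs
  · unfold gap
    exact (Measurable.ite (measurableSet_pre_eq _ _) measurable_const measurable_const).sub
      (Measurable.ite (measurableSet_pre_eq _ _) measurable_const measurable_const)
  · exact measurable_const

theorem measurable_digit (m : ℕ) : Measurable fun x : Digits => ((x m : ℕ) : ℤ) :=
  (measurable_of_countable fun a : Fin (radix m) => ((a : ℕ) : ℤ)).comp (measurable_pi_apply m)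

theorem measurableSet_bad (m : ℕ) : MeasurableSet (bad e i m) := by
  have h : Measurable fun x : Digits => ((x m : ℕ) : ℤ) + stageGap e i m x :=
    (measurable_digit m).add (measurable_stageGap e i m)
  exact ((measurableSet_le measurable_const h).inter
    (measurableSet_lt h measurable_const)).compl

/-- As the intended increment is at most 1 in absolute value, only the two extreme digits can
overflow. -/
theorem measure_bad_le (m : ℕ) : uniformMeasure (bad e i m) ≤ 2 * (radix m : ℝ≥0∞)⁻¹ := by
  have h : bad e i m ⊆
      {x | x m = 0} ∪ {x | x m = ⟨radix m - 1, Nat.sub_lt (one_le_radix m) one_pos⟩} := by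
    intro x hx
    have h1 := abs_le.1 (abs_stageGap_le e i m x)
    have h2 := (x m).2
    simp only [bad, Set.mem_ofPred_eq] at hx
    by_cases h0 : (x m : ℕ) = 0
    · exact Or.inl (Fin.ext (by simpa using h0))
    · exact Or.inr (Fin.ext (by simp only; omega))
  refine (measure_mono h).trans ((measure_union_le _ _).trans ?_)
  rw [uniformMeasure_digit_eq, uniformMeasure_digit_eq, two_mul]

theorem radix_mul_two_pow_le (m p : ℕ) : radix m * 2 ^ p ≤ radix (m + p) := by
  rw [radix, radix, ← pow_add]
  refine Nat.pow_le_pow_right two_pos ?_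
  induction p with
  | zero => simp
  | succ p ih =>
    have : 1 ≤ 3 ^ (m + p) := Nat.one_le_pow _ _ (by norm_num)
    rw [← add_assoc m p 1, pow_succ]
    omega

theorem tsum_measure_bad_le (m : ℕ) :
    ∑' p, uniformMeasure (bad e i (m + p)) ≤ 4 * (radix m : ℝ≥0∞)⁻¹ := by
  calc ∑' p, uniformMeasure (bad e i (m + p))
      ≤ ∑' p : ℕ, 2 * (radix m : ℝ≥0∞)⁻¹ * (2⁻¹) ^ p := by
        refine ENNReal.tsum_le_tsum fun p => (measure_bad_le e i _).trans ?_
        rw [mul_assoc]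
        gcongr
        rw [← ENNReal.inv_pow, ← ENNReal.mul_inv (by simp) (by simp)]
        gcongr
        exact_mod_cast radix_mul_two_pow_le m p
    _ = 4 * (radix m : ℝ≥0∞)⁻¹ := by
        rw [ENNReal.tsum_mul_left, ENNReal.tsum_geometric, ENNReal.one_sub_inv_two, inv_inv]
        ring

theorem ae_mem_good : ∀ᵐ x ∂uniformMeasure, x ∈ good e i := by
  have h : ∑' m, uniformMeasure (bad e i m) ≠ ∞ := by
    have h0 := tsum_measure_bad_le e i 0
    simp only [zero_add] at h0
    exact ne_top_of_le_ne_top (ENNReal.mul_ne_top (by simp) (by simp [NeZero.ne])) h0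
  filter_upwards [ae_eventually_notMem h] with x hx
  exact eventually_atTop.1 hx

theorem measurableSet_good : MeasurableSet (good e i) := by
  have : good e i = ⋃ K, ⋂ m, ⋂ (_ : K ≤ m), (bad e i m)ᶜ := by
    ext x
    simp [good]
  rw [this]
  exact MeasurableSet.iUnion fun K => MeasurableSet.iInter fun m => MeasurableSet.iInter fun _ =>
    (measurableSet_bad e i m).compl

theorem measurable_limitMap : Measurable (limitMap e i) := by
  classical
  refine measurable_of_tendsto_metrizable
    (f := fun n x => if x ∈ good e i then approx e i n x else x) (fun n => ?_) ?_
  · exact Measurable.ite (measurableSet_good e i) (isLocal_approx e i n).measurable measurable_id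
  · rw [tendsto_pi_nhds]
    intro x
    by_cases hx : x ∈ good e i
    · simp only [hx, if_true]
      obtain ⟨K, hK⟩ := hx
      rw [tendsto_pi_nhds]
      intro j
      refine tendsto_const_nhds.congr' ?_
      filter_upwards [eventually_ge_atTop (max K (j + 1))] with n hn
      exact pre_eq_iff.1 (pre_limitMap fun l hl => hK l (by omega)) j (by omega)
    · simp only [hx, if_false]
      rw [limitMap, dif_neg (show ¬∃ K, ∀ m, K ≤ m → x ∉ bad e i m from hx)]
      exact tendsto_const_nhds

/-- Almost every point eventually has the same prefix under `approx` as under the limit, so the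
measures of preimages of cylinders converge. -/
theorem measurePreserving_limitMap :
    MeasurePreserving (limitMap e i) uniformMeasure uniformMeasure := by
  refine measurePreserving_of_cylinders 0 (measurable_limitMap e i) fun n _ z => ?_
  have h := tendsto_measure_of_ae_tendsto_indicator_of_isFiniteMeasure atTop
    (μ := uniformMeasure) (A := limitMap e i ⁻¹' {x | pre n x = pre n z})
    (As := fun m => approx e i m ⁻¹' {x | pre n x = pre n z})
    (measurable_limitMap e i (measurableSet_pre_eq _ _))
    (fun m => (isLocal_approx e i m).measurable (measurableSet_pre_eq _ _)) (by
      filter_upwards [ae_mem_good e i] with x hx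
      obtain ⟨K, hK⟩ := hx
      filter_upwards [eventually_ge_atTop (max K n)] with m hm
      have := pre_eq_of_le (le_of_max_le_right hm)
        (pre_limitMap fun l hl => hK l ((le_of_max_le_left hm).trans hl))
      simp only [Set.mem_preimage, Set.mem_ofPred_eq, this])
  refine tendsto_nhds_unique h (tendsto_const_nhds.congr fun m => ?_)
  exact ((isLocal_approx e i m).measurePreserving.measure_preimage
    (measurableSet_pre_eq _ _).nullMeasurableSet).symm

theorem radix_succ (m : ℕ) : radix (m + 1) = radix m ^ 3 := by
  rw [radix, radix, ← pow_mul, pow_succ]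

/-- The failure of the `m`-th digit to have coboundary `stageGap`. -/
noncomputable def coboundaryError (m : ℕ) (x : Digits) : ℝ :=
  (((limitMap e i x m : ℕ) : ℤ) - ((x m : ℕ) : ℤ) - stageGap e i m x : ℤ)

theorem measurable_coboundaryError (m : ℕ) : Measurable (coboundaryError e i m) :=
  (measurable_of_countable fun z : ℤ => (z : ℝ)).comp
    ((((measurable_digit m).comp (measurable_limitMap e i)).sub (measurable_digit m)).sub
      (measurable_stageGap e i m))

theorem abs_coboundaryError_le (m : ℕ) (x : Digits) : |coboundaryError e i m x| ≤ radix m := by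
  have h1 := abs_le.1 (abs_stageGap_le e i m x)
  have h2 := (x m).2
  have h3 := (limitMap e i x m).2
  rw [coboundaryError, ← Int.cast_abs]
  have : |((limitMap e i x m : ℕ) : ℤ) - ((x m : ℕ) : ℤ) - stageGap e i m x| ≤ radix m := by
    rw [abs_le]
    omega
  exact_mod_cast this

/-- With r = `radix m`: the error is at most 1 on `bad e i m`, of measure at most 2 / r, if no later
overflow occurs. Later overflows have measure at most 4 / r³ and error at most r. Elsewhere the
error is 0. The total is 2 / r + (4 / r³) r². -/
theorem integral_coboundaryError_sq_le (m : ℕ) :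
    ∫ x, coboundaryError e i m x ^ 2 ∂uniformMeasure ≤ 6 / radix m := by
  set U : Set Digits := ⋃ p, bad e i (m + 1 + p) with hU
  have hUm : MeasurableSet U := MeasurableSet.iUnion fun p => measurableSet_bad e i _
  have hR : (0 : ℝ) < radix m := by exact_mod_cast one_le_radix m
  have hle : ∀ x, coboundaryError e i m x ^ 2 ≤
      (bad e i m).indicator (fun _ => (1 : ℝ)) x + U.indicator (fun _ => (radix m : ℝ) ^ 2) x := by
    intro x
    have h0 : 0 ≤ (bad e i m).indicator (fun _ => (1 : ℝ)) x :=
      Set.indicator_nonneg (fun _ _ => zero_le_one) x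
    by_cases hx : x ∈ U
    · rw [Set.indicator_of_mem hx]
      have := sq_le_sq' (abs_le.1 (abs_coboundaryError_le e i m x)).1
        (abs_le.1 (abs_coboundaryError_le e i m x)).2
      linarith
    · have hx' : ∀ l, m < l → x ∉ bad e i l := by
        intro l hl hb
        exact hx (Set.mem_iUnion.2 ⟨l - (m + 1), by rwa [Nat.add_sub_cancel' hl]⟩)
      rw [Set.indicator_of_notMem hx, add_zero]
      by_cases hb : x ∈ bad e i m
      · rw [Set.indicator_of_mem hb, coboundaryError, limitMap_of_mem_bad hx' hb, sub_self,
          zero_sub, Int.cast_neg, neg_sq, sq_le_one_iff_abs_le_one]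
        exact_mod_cast abs_stageGap_le e i m x
      · rw [coboundaryError, limitMap_sub, sub_self]
        · simpa using h0
        · intro l hl
          rcases hl.eq_or_lt with rfl | hl
          exacts [hb, hx' l hl]
  have h1 : uniformMeasure.real (bad e i m) ≤ 2 / radix m := by
    have := ENNReal.toReal_mono (by simp [ENNReal.mul_eq_top, NeZero.ne]) (measure_bad_le e i m)
    simpa [Measure.real, div_eq_mul_inv] using this
  have h2 : uniformMeasure.real U ≤ 4 / (radix m : ℝ) ^ 3 := by
    have := ENNReal.toReal_mono (by simp [ENNReal.mul_eq_top, NeZero.ne])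
      ((measure_iUnion_le _).trans (tsum_measure_bad_le e i (m + 1)))
    simpa [Measure.real, div_eq_mul_inv, radix_succ] using this
  have hi1 : Integrable ((bad e i m).indicator fun _ => (1 : ℝ)) uniformMeasure :=
    (integrable_const _).indicator (measurableSet_bad e i m)
  have hi2 : Integrable (U.indicator fun _ => (radix m : ℝ) ^ 2) uniformMeasure :=
    (integrable_const _).indicator hUm
  calc ∫ x, coboundaryError e i m x ^ 2 ∂uniformMeasure
      ≤ ∫ x, (bad e i m).indicator (fun _ => (1 : ℝ)) x +
          U.indicator (fun _ => (radix m : ℝ) ^ 2) x ∂uniformMeasure :=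
        integral_mono_of_nonneg (ae_of_all _ fun x => sq_nonneg _) (hi1.add hi2)
          (ae_of_all _ hle)
    _ = uniformMeasure.real (bad e i m) + uniformMeasure.real U * (radix m : ℝ) ^ 2 := by
        rw [integral_add hi1 hi2, integral_indicator_const _ (measurableSet_bad e i m),
          integral_indicator_const _ hUm]
        simp
    _ ≤ 2 / radix m + 4 / (radix m : ℝ) ^ 3 * (radix m : ℝ) ^ 2 := by gcongr
    _ = 6 / radix m := by
        field_simp
        norm_num

end ShearTask

/-! ### Two integration lemmas -/

theorem ae_eq_const_of_forall_setIntegral_eq {Ω : Type*} [m : MeasurableSpace Ω] {ν : Measure Ω}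
    [IsProbabilityMeasure ν] {C : Set (Set Ω)} (hgen : m = MeasurableSpace.generateFrom C)
    (hC : IsPiSystem C) {f : Ω → ℝ} (hf : Integrable f ν) {c : ℝ} (hc : ∫ x, f x ∂ν = c)
    (h : ∀ s ∈ C, ∫ x in s, f x ∂ν = ν.real s * c) : ∀ᵐ x ∂ν, f x = c := by
  refine Integrable.ae_eq_of_forall_setIntegral_eq _ _ hf (integrable_const c) fun s hs _ => ?_
  rw [setIntegral_const, smul_eq_mul]
  induction s, hs using MeasurableSpace.induction_on_inter hgen hC with
  | empty => simp
  | basic s hs => exact h s hs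
  | compl s hs ih =>
    have h1 := integral_add_compl hs hf
    rw [probReal_compl_eq_one_sub hs]
    linear_combination h1 - ih (measure_lt_top _ _) + hc
  | iUnion t hd ht ih =>
    have h1 := hasSum_integral_iUnion ht hd hf.integrableOn
    have h2 := hasSum_integral_iUnion (μ := ν) (f := fun _ => c) ht hd
      (integrable_const c).integrableOn
    simp only [setIntegral_const, smul_eq_mul] at h2
    simp only [ih _ (measure_lt_top _ _)] at h1
    exact h1.unique h2

theorem abs_integral_mul_le_add {Ω : Type*} [MeasurableSpace Ω] {ν : Measure Ω} {f g : Ω → ℝ}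
    (hf : MemLp f 2 ν) (hg : MemLp g 2 ν) {δ : ℝ} (hδ : 0 < δ) :
    |∫ x, f x * g x ∂ν| ≤ δ * ∫ x, f x ^ 2 ∂ν + δ⁻¹ * ∫ x, g x ^ 2 ∂ν := by
  have h1 : Integrable (fun x => δ * f x ^ 2) ν := hf.integrable_sq.const_mul δ
  have h2 : Integrable (fun x => δ⁻¹ * g x ^ 2) ν := hg.integrable_sq.const_mul δ⁻¹
  rw [← integral_const_mul, ← integral_const_mul, ← integral_add h1 h2]
  refine (abs_integral_le_integral_abs).trans
    (integral_mono_of_nonneg (ae_of_all _ fun x => abs_nonneg _) (h1.add h2)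
      (ae_of_all _ fun x => ?_))
  have h3 : δ * f x ^ 2 + δ⁻¹ * g x ^ 2 =
      δ⁻¹ * ((δ * |f x| - |g x|) ^ 2 + δ * |f x| * |g x|) + |f x * g x| := by
    rw [abs_mul, ← sq_abs (f x), ← sq_abs (g x)]
    field_simp
    ring
  have h4 : 0 ≤ δ⁻¹ * ((δ * |f x| - |g x|) ^ 2 + δ * |f x| * |g x|) := by positivity
  linarith

/-! ### Restricting almost invertible maps to a free group action -/

section Restriction

variable {d : ℕ} {Z : Type*} [MeasurableSpace Z] {μ : Measure Z}

theorem measurePreserving_smul_of_generators {Y : Set Z} [MulAction (FreeGroup (Fin d)) Y]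
    (hY : MeasurableSet Y) (hY' : ∀ᵐ x ∂μ, x ∈ Y) {T : Fin d → Z → Z}
    (hT : ∀ i, MeasurePreserving (T i) μ μ)
    (hact : ∀ i (y : Y), ((FreeGroup.of i • y : Y) : Z) = T i y)
    (hmeas : ∀ g : FreeGroup (Fin d), Measurable fun y : Y => g • y) (g : FreeGroup (Fin d)) :
    MeasurePreserving (fun y : Y => g • y) (μ.comap (↑)) (μ.comap (↑)) := by
  have hemb := MeasurableEmbedding.subtype_coe hY
  have hval : (μ.comap ((↑) : Y → Z)).map (↑) = μ := by
    rw [hemb.map_comap, Subtype.range_coe, Measure.restrict_eq_self_of_ae_mem hY']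
  induction g using FreeGroup.induction_on with
  | C1 =>
    simp only [one_smul]
    exact MeasurePreserving.id _
  | of i =>
    refine ⟨hmeas _, ?_⟩
    rw [← hemb.comap_map ((μ.comap ((↑) : Y → Z)).map fun y => FreeGroup.of i • y),
      Measure.map_map measurable_subtype_coe (hmeas _)]
    have : ((↑) : Y → Z) ∘ (fun y => FreeGroup.of i • y) = T i ∘ (↑) := funext (hact i)
    rw [this, ← Measure.map_map (hT i).measurable measurable_subtype_coe, hval, (hT i).map_eq]
  | inv_of i h =>
    refine ⟨hmeas _, ?_⟩
    conv_lhs => rw [← h.map_eq]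
    rw [Measure.map_map (hmeas _) (hmeas _)]
    have : (fun y : Y => (FreeGroup.of i)⁻¹ • y) ∘ (fun y => FreeGroup.of i • y) = id :=
      funext fun y => inv_smul_smul _ _
    rw [this, Measure.map_id]
  | mul g g' h h' =>
    have := h.comp h'
    simpa only [mul_smul, Function.comp_def] using this

variable [StandardBorelSpace Z]

/-- An injective Borel map on a Borel set is a measurable embedding, so its inverse extends to a
Borel map `S`. Both `S ∘ T = id` and `T ∘ S = id` hold almost everywhere because `T` preserves `μ`.
-/
theorem exists_measurePreserving_leftInverse {T : Z → Z} (hT : MeasurePreserving T μ μ)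
    {G : Set Z} (hG : MeasurableSet G) (hG' : ∀ᵐ x ∂μ, x ∈ G) (hinj : Set.InjOn T G) :
    ∃ S : Z → Z, MeasurePreserving S μ μ ∧ (∀ x ∈ G, S (T x) = x) ∧ ∀ᵐ x ∂μ, T (S x) = x := by
  have := hG.standardBorel
  have hemb : MeasurableEmbedding (fun x : G => T x) :=
    (hT.measurable.comp measurable_subtype_coe).measurableEmbedding
      fun x y h => Subtype.ext (hinj x.2 y.2 h)
  obtain ⟨S, hS, hST⟩ := hemb.exists_measurable_extend measurable_subtype_coe fun y => ⟨y⟩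
  have hST' : ∀ x ∈ G, S (T x) = x := fun x hx => congrFun hST ⟨x, hx⟩
  refine ⟨S, ⟨hS, ?_⟩, hST', ?_⟩
  · conv_lhs => rw [← hT.map_eq]
    rw [Measure.map_map hS hT.measurable]
    have : S ∘ T =ᵐ[μ] id := by
      filter_upwards [hG'] with x hx using hST' x hx
    rw [Measure.map_congr this, Measure.map_id]
  · have hm : MeasurableSet {x | T (S x) = x} :=
      measurableSet_eq_fun (hT.measurable.comp hS) measurable_id
    rw [← hT.map_eq, ae_map_iff hT.measurable.aemeasurable hm]
    filter_upwards [hG'] with x hx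
    rw [hST' x hx]

theorem exists_freeGroup_action {T : Fin d → Z → Z} (hT : ∀ i, MeasurePreserving (T i) μ μ)
    {G : Fin d → Set Z} (hG : ∀ i, MeasurableSet (G i)) (hG' : ∀ i, ∀ᵐ x ∂μ, x ∈ G i)
    (hinj : ∀ i, Set.InjOn (T i) (G i)) :
    ∃ (Y : Set Z) (_ : MulAction (FreeGroup (Fin d)) Y), MeasurableSet Y ∧ (∀ᵐ x ∂μ, x ∈ Y) ∧
      (∀ i, Y ⊆ G i) ∧ (∀ i (y : Y), ((FreeGroup.of i • y : Y) : Z) = T i y) ∧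
      ∀ g : FreeGroup (Fin d), Measurable fun y : Y => g • y := by
  choose S hS hST hTS using fun i =>
    exists_measurePreserving_leftInverse (hT i) (hG i) (hG' i) (hinj i)
  let step : Fin d × Bool → Z → Z := fun p => if p.2 then T p.1 else S p.1
  have hstep : ∀ p, MeasurePreserving (step p) μ μ := by
    rintro ⟨i, b⟩
    cases b
    exacts [hS i, hT i]
  -- The head of the list acts first, so `word w (step p x)` is `word (p :: w) x`; this makes `Y`
  -- below invariant.
  let word : List (Fin d × Bool) → Z → Z := fun w => w.foldr (fun p f => f ∘ step p) id
  have hword : ∀ w, MeasurePreserving (word w) μ μ := by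
    intro w
    induction w with
    | nil => exact MeasurePreserving.id μ
    | cons p w ih => exact ih.comp (hstep p)
  let N : Set Z := ⋂ i, G i ∩ {x | T i (S i x) = x}
  have hN : MeasurableSet N := MeasurableSet.iInter fun i => (hG i).inter
    (measurableSet_eq_fun ((hT i).measurable.comp (hS i).measurable) measurable_id)
  have hN' : ∀ᵐ x ∂μ, x ∈ N := by
    filter_upwards [ae_all_iff.2 hG', ae_all_iff.2 hTS] with x h1 h2
    exact Set.mem_iInter.2 fun i => ⟨h1 i, h2 i⟩
  let Y : Set Z := ⋂ w, word w ⁻¹' N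
  have hYN : ∀ x ∈ Y, ∀ i, x ∈ G i ∧ T i (S i x) = x :=
    fun x hx => Set.mem_iInter.1 (Set.mem_iInter.1 hx [])
  have hYstep : ∀ x ∈ Y, ∀ p, step p x ∈ Y :=
    fun x hx p => Set.mem_iInter.2 fun w => Set.mem_iInter.1 hx (p :: w)
  let gen : Fin d → Equiv.Perm Y := fun i =>
    { toFun := fun y => ⟨T i y, hYstep y y.2 (i, true)⟩
      invFun := fun y => ⟨S i y, hYstep y y.2 (i, false)⟩
      left_inv := fun y => Subtype.ext (hST i y (hYN y y.2 i).1)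
      right_inv := fun y => Subtype.ext (hYN y y.2 i).2 }
  refine ⟨Y, MulAction.compHom Y (FreeGroup.lift gen), ?_, ?_, ?_, ?_, ?_⟩
  · exact MeasurableSet.iInter fun w => (hword w).measurable hN
  · have : ∀ᵐ x ∂μ, ∀ w, word w x ∈ N :=
      ae_all_iff.2 fun w => (hword w).quasiMeasurePreserving.ae hN'
    filter_upwards [this] with x hx using Set.mem_iInter.2 hx
  · exact fun i y hy => (hYN y hy i).1
  · intro i y
    change ((FreeGroup.lift gen (FreeGroup.of i) y : Y) : Z) = T i y
    rw [FreeGroup.lift_apply_of]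
    rfl
  · intro g
    change Measurable (FreeGroup.lift gen g)
    induction g using FreeGroup.induction_on with
    | C1 => exact (map_one (FreeGroup.lift gen)).symm ▸ measurable_id
    | of i =>
      rw [FreeGroup.lift_apply_of]
      exact ((hT i).measurable.comp measurable_subtype_coe).subtype_mk
    | inv_of i _ =>
      rw [map_inv, FreeGroup.lift_apply_of]
      exact ((hS i).measurable.comp measurable_subtype_coe).subtype_mk
    | mul g g' h h' =>
      rw [map_mul]
      exact h.comp h'

end Restriction

/-! ### Edge potentials for the constructed action -/

namespace Digits

theorem exists_forall_pre_ne (F : Finset Digits) (y : Digits) :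
    ∃ k, ∀ x ∈ F, x ≠ y → ∀ n, k ≤ n → pre n x ≠ pre n y := by
  have h : ∀ᶠ k in Filter.atTop, ∀ x ∈ F, x ≠ y → pre k x ≠ pre k y := by
    refine (Filter.eventually_all_finset F).2 fun x _ => ?_
    by_cases hxy : x = y
    · simp [hxy]
    · obtain ⟨j, hj⟩ := Function.ne_iff.1 hxy
      filter_upwards [Filter.eventually_gt_atTop j] with k hk _ hp
      exact hj (pre_eq_iff.1 hp j hk)
  obtain ⟨k, hk⟩ := Filter.eventually_atTop.1 h
  exact ⟨k, fun x hx hxy n hn => hk n hn x hx hxy⟩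

theorem infinite_digits : Infinite Digits := by
  have : ∀ k, Nontrivial (Fin (radix k)) := fun k =>
    Fin.nontrivial_iff_two_le.2 (Nat.le_self_pow (Nat.pow_pos (by norm_num)).ne' 2)
  exact Pi.infinite_of_left

end Digits

namespace ShearTask

open Digits

variable {d : ℕ} {e : ℕ → ShearTask d}

theorem stageGap_of_eq {m k : ℕ} (hk : k ≤ m) {i : Fin d} {u w : Prefix k}
    (hm : e m = (i, ⟨k, u, w⟩)) (j : Fin d) (x : Digits) :
    stageGap e j m x = if j = i then gap u w x else 0 := by
  unfold stageGap
  rw [hm]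
  by_cases h : j = i
  · simp [h, hk]
  · simp [h, Ne.symm h]

theorem exists_recurrent_sequence (d : ℕ) (hd : 0 < d) :
    ∃ e : ℕ → ShearTask d, ∀ t N, ∃ m, N ≤ m ∧ e m = t := by
  have : Nonempty (ShearTask d) := ⟨(⟨0, hd⟩, ⟨0, fun _ => 0, fun _ => 0⟩)⟩
  obtain ⟨f, hf⟩ := exists_surjective_nat (ShearTask d)
  refine ⟨fun n => f n.unpair.1, fun t N => ?_⟩
  obtain ⟨a, ha⟩ := hf t
  exact ⟨Nat.pair a N, Nat.right_le_pair a N, by simp [ha]⟩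

variable {Y : Set Digits} [MulAction (FreeGroup (Fin d)) Y]

/-- A late digit `m` serving the task below is the potential: beyond the last overflow of the points
of `F` its gradient is exactly `stageGap`. -/
theorem hasEdgePotentials (he : ∀ t N, ∃ m, N ≤ m ∧ e m = t)
    (hgood : ∀ i, Y ⊆ good e i)
    (hact : ∀ i (y : Y), ((FreeGroup.of i • y : Y) : Digits) = limitMap e i y) :
    HasEdgePotentials d Y := by
  classical
  intro F b i
  have := infinite_digits
  let F' : Finset Digits := insert (b : Digits) (F.image (↑))
  have hF' : ∀ x ∈ F, (x : Digits) ∈ F' := fun x hx =>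
    Finset.mem_insert_of_mem (Finset.mem_image_of_mem _ hx)
  -- The cylinder of `z` misses `F`, and that of `b` contains no other point of `F`, so on `F` the
  -- gap is the indicator of `b`.
  obtain ⟨z, hz⟩ := Infinite.exists_notMem_finset F'
  obtain ⟨k₁, hk₁⟩ := exists_forall_pre_ne F' b
  obtain ⟨k₂, hk₂⟩ := exists_forall_pre_ne F' z
  let k := max k₁ k₂
  have hK : ∀ᶠ K in Filter.atTop, ∀ x ∈ F, ∀ j, ∀ l, K ≤ l → (x : Digits) ∉ bad e j l := by
    refine (Filter.eventually_all_finset F).2 fun x _ => Filter.eventually_all.2 fun j => ?_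
    obtain ⟨K, hK⟩ := hgood j x.2
    filter_upwards [Filter.eventually_ge_atTop K] with K' hK' l hl
    exact hK l (hK'.trans hl)
  obtain ⟨K, hK⟩ := Filter.eventually_atTop.1 hK
  obtain ⟨m, hm, hem⟩ := he (i, ⟨k, pre k b, pre k z⟩) (max k K)
  refine ⟨fun y => (((y : Digits) m : ℕ) : ℤ), fun x hx j => ?_⟩
  have h1 := limitMap_sub (fun l hl => hK m (le_of_max_le_right hm) x hx j l hl)
  rw [stageGap_of_eq (le_of_max_le_left hm) hem] at h1
  simp only [hact]
  rw [h1, gap, if_neg (hk₂ _ (hF' x hx) (fun h => hz (h ▸ hF' x hx)) k (le_max_right _ _))]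
  constructor
  · rintro ⟨rfl, rfl⟩
    simp
  · intro h
    by_cases hj : j = i
    · rw [if_pos hj, if_neg (hk₁ _ (hF' x hx) (fun hxb => h ⟨hj, Subtype.ext hxb⟩) k
        (le_max_left _ _)), sub_zero]
    · rw [if_neg hj]

/-! ### Rigidity of circulations -/

section Rigidity

variable {ν : Measure Y} [IsProbabilityMeasure ν]

/-- Pair the circulation with the gradient of digit `m`. The pairing vanishes, and the gradient is
the gap in coordinate `i` plus `coboundaryError` in all coordinates. -/
theorem abs_integral_mul_gap_le (hY : MeasurableSet Y)
    (hval : MeasurePreserving ((↑) : Y → Digits) ν uniformMeasure)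
    (hmp : ∀ g : FreeGroup (Fin d), MeasurePreserving (fun y : Y => g • y) ν ν)
    (hact : ∀ i (y : Y), ((FreeGroup.of i • y : Y) : Digits) = limitMap e i y)
    {F : Fin d → Y → ℝ} (hF : ∀ i, MemLp (F i) 2 ν)
    (hsum : ∀ᵐ y ∂ν, ∑ i, F i y = ∑ i, F i ((FreeGroup.of i)⁻¹ • y))
    {m k : ℕ} (hk : k ≤ m) {i : Fin d} {u w : Prefix k} (hm : e m = (i, ⟨k, u, w⟩))
    {δ : ℝ} (hδ : 0 < δ) :
    |∫ y, F i y * gap u w (y : Digits) ∂ν| ≤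
      δ * ∑ j, ∫ y, F j y ^ 2 ∂ν + δ⁻¹ * (d * (6 / radix m)) := by
  let h : Y → ℝ := fun y => (((y : Digits) m : ℕ) : ℝ)
  have hh : Measurable h := (measurable_of_countable fun a : Fin (radix m) => ((a : ℕ) : ℝ)).comp
    ((measurable_pi_apply m).comp measurable_subtype_coe)
  have hhb : ∀ y, ‖h y‖ ≤ radix m := fun y => by
    rw [Real.norm_eq_abs, abs_of_nonneg (Nat.cast_nonneg _)]
    exact Nat.cast_le.2 ((y : Digits) m).2.le
  have hint : ∀ j, Integrable (F j) ν := fun j => (hF j).integrable (by norm_num)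
  have herr : ∀ j, MemLp (fun y : Y => coboundaryError e j m y) 2 ν := fun j =>
    MemLp.of_bound ((measurable_coboundaryError e j m).comp
      measurable_subtype_coe).aestronglyMeasurable (radix m)
      (ae_of_all _ fun y => abs_coboundaryError_le e j m y)
  have hFh : ∀ j, Integrable (fun y => F j y * h y) ν := fun j =>
    (hint j).mul_bdd hh.aestronglyMeasurable (ae_of_all _ hhb)
  have hFh' : ∀ j, Integrable (fun y => F j y * h (FreeGroup.of j • y)) ν := fun j =>
    (hint j).mul_bdd (hh.comp (hmp _).measurable).aestronglyMeasurable
      (ae_of_all _ fun y => hhb _)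
  have hFh'' : ∀ j, Integrable (fun y => F j ((FreeGroup.of j)⁻¹ • y) * h y) ν := fun j => by
    have := (hmp (FreeGroup.of j)⁻¹).integrable_comp_of_integrable (hFh' j)
    simpa [Function.comp_def] using this
  have hshift : ∀ j, ∫ y, F j y * h (FreeGroup.of j • y) ∂ν =
      ∫ y, F j ((FreeGroup.of j)⁻¹ • y) * h y ∂ν := fun j => by
    have h1 := (hmp (FreeGroup.of j)⁻¹).map_eq
    conv_lhs => rw [← h1]
    rw [integral_map (hmp _).measurable.aemeasurable]
    · simp
    · rw [h1]
      exact (hFh' j).aestronglyMeasurable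
  have hzero : ∑ j, ∫ y, F j y * (h (FreeGroup.of j • y) - h y) ∂ν = 0 := by
    simp_rw [mul_sub]
    rw [Finset.sum_congr rfl fun j _ => integral_sub (hFh' j) (hFh j), Finset.sum_sub_distrib,
      Finset.sum_congr rfl fun j _ => hshift j, ← integral_finsetSum _ fun j _ => hFh'' j,
      ← integral_finsetSum _ fun j _ => hFh j, sub_eq_zero]
    refine integral_congr_ae ?_
    filter_upwards [hsum] with y hy
    rw [← Finset.sum_mul, ← Finset.sum_mul, hy]
  have hdecomp : ∀ j y, F j y * (h (FreeGroup.of j • y) - h y) =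
      F j y * coboundaryError e j m y + if j = i then F i y * gap u w (y : Digits) else 0 := by
    intro j y
    have h1 : coboundaryError e j m y =
        h (FreeGroup.of j • y) - h y - stageGap e j m y := by
      simp only [coboundaryError, h, hact]
      push_cast
      ring
    rw [h1, stageGap_of_eq hk hm]
    split_ifs with hj
    · subst hj
      ring
    · simp
  have hgapint : Integrable (fun y => F i y * gap u w (y : Digits)) ν := by
    have h1 := (((hFh' i).sub (hFh i)).sub ((hF i).integrable_mul (herr i)))
    refine h1.congr (ae_of_all _ fun y => ?_)
    have h2 := hdecomp i y
    rw [if_pos rfl] at h2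
    simp only [Pi.sub_apply, Pi.mul_apply]
    linarith
  have hI : ∫ y, F i y * gap u w (y : Digits) ∂ν =
      -∑ j, ∫ y, F j y * coboundaryError e j m y ∂ν := by
    rw [eq_neg_iff_add_eq_zero, ← hzero]
    have h1 : ∀ j, ∫ y, F j y * (h (FreeGroup.of j • y) - h y) ∂ν =
        ∫ y, F j y * coboundaryError e j m y ∂ν +
          if j = i then ∫ y, F i y * gap u w (y : Digits) ∂ν else 0 := by
      intro j
      simp_rw [hdecomp]
      by_cases hj : j = i
      · simp only [hj, if_true]
        exact integral_add ((hF i).integrable_mul (herr i)) hgapint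
      · simp [hj]
    rw [Finset.sum_congr rfl fun j _ => h1 j, Finset.sum_add_distrib]
    simp [add_comm]
  rw [hI, abs_neg]
  refine (Finset.abs_sum_le_sum_abs _ _).trans ?_
  calc ∑ j, |∫ y, F j y * coboundaryError e j m y ∂ν|
      ≤ ∑ j, (δ * ∫ y, F j y ^ 2 ∂ν + δ⁻¹ * (6 / radix m)) := by
        refine Finset.sum_le_sum fun j _ => (abs_integral_mul_le_add (hF j) (herr j) hδ).trans ?_
        gcongr
        refine le_of_eq_of_le ?_ (integral_coboundaryError_sq_le e j m)
        exact hval.integral_comp (MeasurableEmbedding.subtype_coe hY)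
          fun x => coboundaryError e j m x ^ 2
    _ = _ := by
        rw [Finset.sum_add_distrib, ← Finset.mul_sum]
        simp only [Finset.sum_const, Finset.card_univ, Fintype.card_fin, nsmul_eq_mul]
        ring

theorem integral_mul_gap_eq_zero (hY : MeasurableSet Y) (he : ∀ t N, ∃ m, N ≤ m ∧ e m = t)
    (hval : MeasurePreserving ((↑) : Y → Digits) ν uniformMeasure)
    (hmp : ∀ g : FreeGroup (Fin d), MeasurePreserving (fun y : Y => g • y) ν ν)
    (hact : ∀ i (y : Y), ((FreeGroup.of i • y : Y) : Digits) = limitMap e i y)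
    {F : Fin d → Y → ℝ} (hF : ∀ i, MemLp (F i) 2 ν)
    (hsum : ∀ᵐ y ∂ν, ∑ i, F i y = ∑ i, F i ((FreeGroup.of i)⁻¹ • y))
    (i : Fin d) {k : ℕ} (u w : Prefix k) :
    ∫ y, F i y * gap u w (y : Digits) ∂ν = 0 := by
  set I := ∫ y, F i y * gap u w (y : Digits) ∂ν with hIdef
  set C := ∑ j, ∫ y, F j y ^ 2 ∂ν with hCdef
  have hC : 0 ≤ C := Finset.sum_nonneg fun j _ => integral_nonneg fun y => sq_nonneg _
  have key : ∀ δ : ℝ, 0 < δ → |I| ≤ δ * (C + 1) := by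
    intro δ hδ
    -- Chosen so that `radix m ≥ 6 d / δ²`, which bounds the error term by `δ`.
    obtain ⟨N, hN⟩ := exists_nat_ge (d * 6 / δ ^ 2)
    obtain ⟨m, hm, hem⟩ := he (i, ⟨k, u, w⟩) (max k N)
    have h1 := abs_integral_mul_gap_le hY hval hmp hact hF hsum (le_of_max_le_left hm) hem hδ
    have h2 : d * 6 / δ ^ 2 ≤ radix m := by
      refine hN.trans (Nat.cast_le.2 ((le_of_max_le_right hm).trans ?_))
      exact (Nat.lt_pow_self (by norm_num)).le.trans (Nat.lt_two_pow_self (n := 3 ^ m)).le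
    have hR : (0 : ℝ) < radix m := by exact_mod_cast one_le_radix m
    have h3 : δ⁻¹ * (d * (6 / radix m)) ≤ δ := by
      rw [div_le_iff₀ (by positivity)] at h2
      rw [inv_mul_le_iff₀ hδ, ← mul_div_assoc, div_le_iff₀ hR]
      linarith
    linarith
  have h0 : |I| ≤ 0 := le_of_forall_pos_le_add fun ε hε => by
    have := key (ε / (C + 1)) (by positivity)
    rwa [div_mul_cancel₀ _ (by positivity), ← zero_add ε] at this
  exact abs_nonpos_iff.1 h0

/-- Cylinders of one length partition the space into pieces of equal mass and equal integral, so the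
integral over each is its mass times the mean. Cylinders form a generating π-system. -/
theorem ae_eq_const_of_integral_mul_gap_eq_zero
    (hval : MeasurePreserving ((↑) : Y → Digits) ν uniformMeasure) {f : Y → ℝ}
    (hf : Integrable f ν)
    (h : ∀ (k : ℕ) (u w : Prefix k), ∫ y, f y * gap u w (y : Digits) ∂ν = 0) :
    ∀ᵐ y ∂ν, f y = ∫ y, f y ∂ν := by
  have hmeas : ∀ k (v : Prefix k), MeasurableSet {y : Y | pre k (y : Digits) = v} := fun k v =>
    measurable_subtype_coe (measurableSet_pre_eq k v)
  have heq : ∀ k (u w : Prefix k), ∫ y in {y : Y | pre k (y : Digits) = u}, f y ∂ν =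
      ∫ y in {y : Y | pre k (y : Digits) = w}, f y ∂ν := by
    intro k u w
    rw [← sub_eq_zero, ← integral_indicator (hmeas k u), ← integral_indicator (hmeas k w),
      ← integral_sub (hf.indicator (hmeas k u)) (hf.indicator (hmeas k w)), ← h k u w]
    refine integral_congr_ae (ae_of_all _ fun y => ?_)
    simp only [Set.indicator, gap, Set.mem_ofPred_eq]
    split_ifs <;> simp
  have hmeasure : ∀ k (u w : Prefix k), ν.real {y : Y | pre k (y : Digits) = u} =
      ν.real {y : Y | pre k (y : Digits) = w} := by
    intro k u w
    have h1 : ∀ v : Prefix k, ν {y : Y | pre k (y : Digits) = v} =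
        uniformMeasure {x | pre k x = v} := fun v =>
      hval.measure_preimage (measurableSet_pre_eq k v).nullMeasurableSet
    rw [Measure.real, Measure.real, h1, h1, uniformMeasure_pre_eq, uniformMeasure_pre_eq]
  have hcover : ∀ k, ⋃ v : Prefix k, {y : Y | pre k (y : Digits) = v} = Set.univ := fun k =>
    Set.eq_univ_of_forall fun y => Set.mem_iUnion.2 ⟨_, rfl⟩
  have hdisj : ∀ k, Pairwise (Function.onFun Disjoint
      fun v : Prefix k => {y : Y | pre k (y : Digits) = v}) := fun k v v' hv =>
    Set.disjoint_left.2 fun y hy hy' => hv (hy.symm.trans hy')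
  refine ae_eq_const_of_forall_setIntegral_eq (C := Set.preimage Subtype.val '' cylinders 0) ?_
    ((isPiSystem_cylinders 0).comap Subtype.val) hf rfl ?_
  · rw [← MeasurableSpace.comap_generateFrom, ← generateFrom_cylinders 0]
    rfl
  · rintro _ ⟨_, ⟨k, -, z, rfl⟩, rfl⟩
    change ∫ y in {y : Y | pre k (y : Digits) = pre k z}, f y ∂ν =
      ν.real {y : Y | pre k (y : Digits) = pre k z} * _
    have h1 := integral_iUnion_fintype (hmeas k) (hdisj k) fun v => hf.integrableOn
    have h2 := integral_iUnion_fintype (μ := ν) (f := fun _ => (1 : ℝ)) (hmeas k) (hdisj k)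
      fun v => (integrable_const _).integrableOn
    rw [hcover, setIntegral_univ, Finset.sum_congr rfl fun v _ => heq k v (pre k z),
      Finset.sum_const, nsmul_eq_mul] at h1
    simp only [hcover, setIntegral_const, smul_eq_mul, mul_one, probReal_univ] at h2
    rw [Finset.sum_congr rfl fun v _ => hmeasure k v (pre k z), Finset.sum_const,
      nsmul_eq_mul] at h2
    rw [h1, mul_left_comm, ← mul_assoc, ← h2, one_mul]

end Rigidity

end ShearTask

theorem theorem3 (d : ℕ) (hd : 2 ≤ d) :
    ∃ (X : Type) (_ : MeasurableSpace X) (_ : StandardBorelSpace X)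
      (μ : Measure X) (_ : IsProbabilityMeasure μ) (_ : MulAction (FreeGroup (Fin d)) X),
      (∀ g : FreeGroup (Fin d), MeasurePreserving (fun x : X => g • x) μ μ) ∧
      IsRegularGraph (schreierGraph d X) (2 * d) ∧
      IsTreeing (schreierGraph d X) μ ∧
      ∀ f : X × X → ℝ, MemLp f 2 (edgeMeasure (schreierGraph d X) μ (2 * d)) →
        (IsCirculation (schreierGraph d X) μ (2 * d) f ↔
          ∃ c : Fin d → ℝ, f =ᵐ[edgeMeasure (schreierGraph d X) μ (2 * d)]
            fun e => ∑ i, c i * generatorCirculation i e) := by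
  obtain ⟨e, he⟩ := ShearTask.exists_recurrent_sequence d (by omega)
  obtain ⟨Y, hYact, hY, hY', hgood, hact, hmeas⟩ := exists_freeGroup_action
    (ShearTask.measurePreserving_limitMap e) (ShearTask.measurableSet_good e)
    (ShearTask.ae_mem_good e) fun i => ShearTask.limitMap_injOn
  have hstd : StandardBorelSpace Y := hY.standardBorel
  have hmp := measurePreserving_smul_of_generators hY hY'
    (ShearTask.measurePreserving_limitMap e) hact hmeas
  have hval : MeasurePreserving ((↑) : Y → Digits) (Digits.uniformMeasure.comap (↑))
      Digits.uniformMeasure := ⟨measurable_subtype_coe, by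
    rw [(MeasurableEmbedding.subtype_coe hY).map_comap, Subtype.range_coe,
      Measure.restrict_eq_self_of_ae_mem hY']⟩
  have hprob : IsProbabilityMeasure (Digits.uniformMeasure.comap ((↑) : Y → Digits)) := by
    refine ⟨?_⟩
    have := hval.measure_preimage MeasurableSet.univ.nullMeasurableSet
    simpa using this
  have H := ShearTask.hasEdgePotentials he hgood hact
  refine ⟨Y, inferInstance, hstd, Digits.uniformMeasure.comap (↑), hprob, hYact, hmp,
    H.isRegularGraph, H.isTreeing hmp, fun f hf => ?_⟩
  have hd0 : 2 * d ≠ 0 := by omega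
  refine H.isCirculation_iff hmp ?_ hd0 hf
  intro F hF hsum
  refine ⟨fun i => ∫ y, F i y ∂Digits.uniformMeasure.comap (↑), fun i => ?_⟩
  refine ShearTask.ae_eq_const_of_integral_mul_gap_eq_zero hval
    ((hF i).integrable (by norm_num)) fun k u w => ?_
  exact ShearTask.integral_mul_gap_eq_zero hY he hval hmp hact hF hsum i u w
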